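/- For real $\alpha>0$ let the numbers $p_\alpha(n)$, $n\ge 0$, be defined by the formal power series identity $$\sum_{n=0}^\infty p_\alpha(n)x^n=\prod_{k=1}^\infty\frac{1}{(1-x^k)^{\alpha}},$$ where $(1-x^k)^{-\alpha}$ denotes the binomial series $\sum_{j\ge 0}\binom{-\alpha}{j}(-x^k)^j$. Let $$I_\nu(z)=\left(\frac z2\right)^{\nu}\sum_{k=0}^\infty\frac{(z/2)^{2k}}{k!\,\Gamma(\nu+k+1)}$$ be the modified Bessel function of the first kind, and let $\lambda_\alpha(n)=\sqrt{\frac{24n}{\alpha}-1}$ for integers $n\ge\alpha/24$. Then for every real $\alpha>0$, as $n\to\infty$ through the integers, $$p_\alpha(n)\sim 2\pi\,\frac{I_{\frac{\alpha}{2}+1}\!\left(\frac{\pi\alpha}{6}\lambda_\alpha(n)\right)}{\lambda_\alpha(n)^{\frac{\alpha}{2}+1}}\sim\sqrt{\frac{12}{\alpha}}\cdot\frac{e^{\frac{\alpha\pi}{6}\lambda_\alpha(n)}}{\lambda_\alpha(n)^{\frac{\alpha+3}{2}}},$$ where $a(n)\sim b(n)$ means $a(n)/b(n)\to 1$. -/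

import Mathlib

open Filter Asymptotics
open scoped Topology Nat PowerSeries

noncomputable section

namespace FracPartition

open scoped PowerSeries.WithPiTopology

/-- The formal power series `(1 - X ^ k) ^ (-α)` for `k ≥ 1`: the binomial series
`(1 + Y) ^ (-α) = ∑ j, choose (-α) j * Y ^ j` with `Y = -X ^ k` substituted. -/
def eulerFactor (α : ℝ) (k : ℕ) : ℝ⟦X⟧ :=
  (PowerSeries.binomialSeries ℝ (-α)).subst (-(PowerSeries.X : ℝ⟦X⟧) ^ k)

/-- The formal infinite product `∏_{k ≥ 1} (1 - X ^ k) ^ (-α)`, in the topology of coefficientwise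
convergence. -/
def genFun (α : ℝ) : ℝ⟦X⟧ :=
  ∏' k : ℕ, eulerFactor α (k + 1)

/-- The fractional partition function `p_α(n)`: the coefficient of `X ^ n` in
`∏_{k ≥ 1} (1 - X ^ k) ^ (-α)`. -/
def fracPartition (α : ℝ) (n : ℕ) : ℝ :=
  PowerSeries.coeff n (genFun α)

/-- The infinite product that defines `genFun α` converges. -/
theorem multipliable_eulerFactor (α : ℝ) :
    Multipliable fun k : ℕ => eulerFactor α (k + 1) := by
  have key : ∀ k : ℕ, eulerFactor α (k + 1) = 1 + (eulerFactor α (k + 1) - 1) := fun k => by ring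
  rw [funext key]
  apply PowerSeries.WithPiTopology.multipliable_one_add_of_tendsto_order_atTop_nhds_top
  refine ENat.tendsto_nhds_top_iff_natCast_lt.mpr fun n => Filter.eventually_atTop.mpr ⟨n, ?_⟩
  intro m hm
  have hlt : (n : ℕ∞) < ((m + 1 : ℕ) : ℕ∞) := by exact_mod_cast Nat.lt_succ_of_le hm
  refine hlt.trans_le (PowerSeries.le_order _ _ fun i hi => ?_)
  have hi' : i < m + 1 := by exact_mod_cast hi
  have hs : PowerSeries.HasSubst (-(PowerSeries.X : ℝ⟦X⟧) ^ (m + 1)) :=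
    PowerSeries.HasSubst.of_constantCoeff_zero' (by simp)
  rw [map_sub, eulerFactor, PowerSeries.coeff_subst' hs, finsum_eq_single _ 0]
  · simp
  · intro d hd
    have : PowerSeries.coeff i ((-(PowerSeries.X : ℝ⟦X⟧) ^ (m + 1)) ^ d) = 0 := by
      rw [neg_pow, ← pow_mul, ← map_one (PowerSeries.C (R := ℝ)), ← map_neg, ← map_pow,
        PowerSeries.coeff_C_mul, PowerSeries.coeff_X_pow, if_neg, mul_zero]
      have := Nat.le_mul_of_pos_right (m + 1) (Nat.pos_of_ne_zero hd)
      omega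
    rw [this, smul_zero]

/-- The modified Bessel function of the first kind of real order `ν`, for real `z > 0`:
`I_ν(z) = (z / 2) ^ ν * ∑_{k ≥ 0} (z / 2) ^ (2 * k) / (k! * Γ(ν + k + 1))`. -/
def besselI (ν z : ℝ) : ℝ :=
  (z / 2) ^ ν * ∑' k : ℕ, (z / 2) ^ (2 * k) / ((k ! : ℝ) * Real.Gamma (ν + k + 1))

/-- The series that defines `besselI ν z` converges. -/
theorem summable_besselI {ν : ℝ} (hν : 0 ≤ ν) (z : ℝ) :
    Summable fun k : ℕ => (z / 2) ^ (2 * k) / ((k ! : ℝ) * Real.Gamma (ν + k + 1)) := by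
  rcases eq_or_ne z 0 with rfl | hz
  · refine summable_of_ne_finset_zero (s := {0}) fun k hk => ?_
    have : k ≠ 0 := by simpa using hk
    simp [this]
  have hG : ∀ k : ℕ, 0 < Real.Gamma (ν + k + 1) := fun k => Real.Gamma_pos_of_pos (by positivity)
  have hpos : ∀ k : ℕ, 0 < (z / 2) ^ (2 * k) / ((k ! : ℝ) * Real.Gamma (ν + k + 1)) := fun k => by
    have h1 : 0 < (z / 2) ^ (2 * k) := by rw [pow_mul]; positivity
    have := hG k
    have h2 : 0 < (k ! : ℝ) := by exact_mod_cast Nat.factorial_pos k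
    positivity
  refine summable_of_ratio_test_tendsto_lt_one (l := 0) one_pos
    (Eventually.of_forall fun k => (hpos k).ne') ?_
  have hratio : ∀ k : ℕ, ‖(z / 2) ^ (2 * (k + 1)) /
        (((k + 1)! : ℝ) * Real.Gamma (ν + ((k + 1 : ℕ) : ℝ) + 1))‖ /
      ‖(z / 2) ^ (2 * k) / ((k ! : ℝ) * Real.Gamma (ν + k + 1))‖ =
      (z / 2) ^ 2 * ((1 / ((k : ℝ) + 1)) * (ν + k + 1)⁻¹) := fun k => by
    rw [Real.norm_of_nonneg (hpos (k + 1)).le, Real.norm_of_nonneg (hpos k).le]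
    have h0 : ν + (k : ℝ) + 1 ≠ 0 := by positivity
    have h1 : ν + ((k + 1 : ℕ) : ℝ) + 1 = (ν + k + 1) + 1 := by push_cast; ring
    rw [h1, Real.Gamma_add_one h0, Nat.factorial_succ]
    have := (hG k).ne'
    have h2 : (k ! : ℝ) ≠ 0 := by exact_mod_cast Nat.factorial_ne_zero k
    have h3 : (k : ℝ) + 1 ≠ 0 := by positivity
    push_cast
    field_simp
    ring
  rw [funext hratio]
  have t1 : Tendsto (fun k : ℕ => 1 / ((k : ℝ) + 1)) atTop (𝓝 0) :=
    tendsto_one_div_add_atTop_nhds_zero_nat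
  have t2 : Tendsto (fun k : ℕ => (ν + (k : ℝ) + 1)⁻¹) atTop (𝓝 0) :=
    tendsto_inv_atTop_zero.comp (tendsto_atTop_add_const_right _ _
      (tendsto_atTop_add_const_left _ _ tendsto_natCast_atTop_atTop))
  simpa using (t1.mul t2).const_mul ((z / 2) ^ 2)

/-- `λ_α(n) = √(24 n / α - 1)`, used for `n ≥ α / 24`. -/
def lam (α : ℝ) (n : ℕ) : ℝ :=
  Real.sqrt (24 * (n : ℝ) / α - 1)

end FracPartition

end

/-!
The coefficient `p_α(n)` is a Fourier integral of `e ^ (α G(s) + n s)` over the segment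
`Re s = t`, `|Im s| ≤ π`, where `G = logEuler` is the logarithm of `∏ (1 - e ^ (-k s))⁻¹`; this is
Cauchy's formula for the finite products and a passage to the limit (`integral_exp_logEuler`).
Since `α` need not be an integer, the transformation formula of the eta function is needed for
the logarithm `G` itself (`logEuler_eq`):
`G(s) = π² / (6 s) + log (s / 2π) / 2 - s / 24 + G(4π² / s)`.

The choice `t = 2π / λ_α(n)` is the exact saddle point of `α π² / (6 s) + (n - α / 24) s`, so
that with `s = t w`, `w = 1 + iu`, the exponent becomes
`(π α λ / 12) (w + 1 / w) + (α / 2) log (w / λ) + α G(2π λ / w)`. On `|u| ≤ 1` Laplace's method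
applies, because `w + 1 / w - 2 = -u² / w` and the last term is negligible
(`tendsto_integral_saddleKernel`). On the rest of the segment `Re G` is smaller than at the saddle
point by a multiple of `1 / t` (`re_logEuler_le_sub`): in `G(s) = ∑ e ^ (-k m s) / m` every term is
largest in real part at real `s`, and the terms with `m = 1` already lose that much. This gives the
exponential form of the asymptotics (`fracPartition_isEquivalent`).

The Bessel form is equivalent to it because `I_ν(z) ~ e ^ z / √(2π z)` (`besselI_isEquivalent`),
which is Laplace's method for a Poisson-type integral whose expansion in powers of `z` is
the Bessel series (`besselI_eq_integral`).
-/

namespace FracPartition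

open MeasureTheory

/-! ### Generating functions on the unit disc -/

/-- The real formal power series `p` converges on the open complex unit disc, with sum `f`. -/
def HasDiscSum (p : ℝ⟦X⟧) (f : ℂ → ℂ) : Prop :=
  ∀ x : ℂ, ‖x‖ < 1 → HasSum (fun n => ((PowerSeries.coeff n p : ℝ) : ℂ) * x ^ n) (f x)

theorem HasDiscSum.one : HasDiscSum 1 fun _ => 1 := by
  intro x _
  convert hasSum_single (f := fun n => ((PowerSeries.coeff n (1 : ℝ⟦X⟧) : ℝ) : ℂ) * x ^ n) 0 ?_ using 1
  · simp
  · intro n hn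
    simp [PowerSeries.coeff_one, hn]

theorem HasDiscSum.mul {p q : ℝ⟦X⟧} {f g : ℂ → ℂ} (hp : HasDiscSum p f) (hq : HasDiscSum q g) :
    HasDiscSum (p * q) fun x => f x * g x := by
  intro x hx
  have hpn := (hp x hx).summable.norm
  have hqn := (hq x hx).summable.norm
  have key : ∀ n, ((PowerSeries.coeff n (p * q) : ℝ) : ℂ) * x ^ n =
      ∑ kl ∈ Finset.HasAntidiagonal.antidiagonal n, (((PowerSeries.coeff kl.1 p : ℝ) : ℂ) * x ^ kl.1) *
        (((PowerSeries.coeff kl.2 q : ℝ) : ℂ) * x ^ kl.2) := fun n => by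
    rw [PowerSeries.coeff_mul, Complex.ofReal_sum, Finset.sum_mul]
    refine Finset.sum_congr rfl fun kl hkl => ?_
    rw [← Finset.HasAntidiagonal.mem_antidiagonal.mp hkl, pow_add]
    push_cast
    ring
  change HasSum _ (f x * g x)
  rw [funext key, ← (hp x hx).tsum_eq, ← (hq x hx).tsum_eq,
    tsum_mul_tsum_eq_tsum_sum_antidiagonal_of_summable_norm hpn hqn]
  exact (summable_norm_sum_mul_antidiagonal_of_summable_norm hpn hqn).of_norm.hasSum

theorem HasDiscSum.prod {p : ℕ → ℝ⟦X⟧} {f : ℕ → ℂ → ℂ} (h : ∀ k, HasDiscSum (p k) (f k)) (N : ℕ) :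
    HasDiscSum (∏ k ∈ Finset.range N, p k) fun x => ∏ k ∈ Finset.range N, f k x := by
  induction N with
  | zero => simpa using HasDiscSum.one
  | succ N ih => simpa only [Finset.prod_range_succ] using ih.mul (h N)

theorem coeff_eulerFactor_mul (α : ℝ) {k : ℕ} (hk : k ≠ 0) (j : ℕ) :
    PowerSeries.coeff (k * j) (eulerFactor α k) = Ring.choose (-α) j * (-1) ^ j := by
  have hs : PowerSeries.HasSubst (-(PowerSeries.X : ℝ⟦X⟧) ^ k) :=
    PowerSeries.HasSubst.of_constantCoeff_zero' (by simp [hk])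
  rw [eulerFactor, PowerSeries.coeff_subst' hs, finsum_eq_single _ j]
  · rw [neg_pow, ← pow_mul, ← map_one (PowerSeries.C (R := ℝ)), ← map_neg, ← map_pow,
      PowerSeries.coeff_C_mul, PowerSeries.coeff_X_pow]
    simp
  · intro d hd
    rw [neg_pow, ← pow_mul, ← map_one (PowerSeries.C (R := ℝ)), ← map_neg, ← map_pow,
      PowerSeries.coeff_C_mul, PowerSeries.coeff_X_pow, if_neg, mul_zero, smul_zero]
    simpa [hk] using hd.symm

theorem coeff_eulerFactor_of_not_dvd (α : ℝ) {k : ℕ} (hk : k ≠ 0) {n : ℕ} (hn : ¬ k ∣ n) :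
    PowerSeries.coeff n (eulerFactor α k) = 0 := by
  have hs : PowerSeries.HasSubst (-(PowerSeries.X : ℝ⟦X⟧) ^ k) :=
    PowerSeries.HasSubst.of_constantCoeff_zero' (by simp [hk])
  rw [eulerFactor, PowerSeries.coeff_subst' hs]
  refine finsum_eq_zero_of_forall_eq_zero fun d => ?_
  rw [neg_pow, ← pow_mul, ← map_one (PowerSeries.C (R := ℝ)), ← map_neg, ← map_pow,
    PowerSeries.coeff_C_mul, PowerSeries.coeff_X_pow, if_neg, mul_zero, smul_zero]
  rintro rfl
  exact hn (dvd_mul_right _ _)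

theorem hasSum_choose_mul_pow (a : ℝ) {x : ℂ} (hx : ‖x‖ < 1) :
    HasSum (fun n => ((Ring.choose a n : ℝ) : ℂ) * x ^ n) ((1 + x) ^ (a : ℂ)) := by
  have := (Complex.one_add_cpow_hasFPowerSeriesOnBall_zero (a := (a : ℂ))).hasSum (y := x)
    (by simpa [← ofReal_norm] using hx)
  simpa [binomialSeries_apply, Complex.ofReal_choose, -FormalMultilinearSeries.apply_eq_prod_smul_coeff] using this

theorem one_sub_ne_zero_of_norm_lt_one {x : ℂ} (hx : ‖x‖ < 1) : 1 - x ≠ 0 := by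
  intro h
  rw [← sub_eq_zero.mp h, norm_one] at hx
  exact lt_irrefl _ hx

theorem hasDiscSum_eulerFactor (α : ℝ) {k : ℕ} (hk : k ≠ 0) :
    HasDiscSum (eulerFactor α k) fun x => Complex.exp (α * -Complex.log (1 - x ^ k)) := by
  intro x hx
  have hxk : ‖x ^ k‖ < 1 := by
    rw [norm_pow]
    exact pow_lt_one₀ (norm_nonneg _) hx hk
  have h := hasSum_choose_mul_pow (-α) (x := -x ^ k) (by rwa [norm_neg])
  rw [← sub_eq_add_neg, Complex.cpow_def_of_ne_zero (one_sub_ne_zero_of_norm_lt_one hxk)] at h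
  have hinj : Function.Injective fun j : ℕ => k * j := fun a b hab =>
    Nat.eq_of_mul_eq_mul_left (Nat.pos_of_ne_zero hk) hab
  rw [← hinj.hasSum_iff]
  · convert h using 1
    · funext j
      simp only [Function.comp_apply, coeff_eulerFactor_mul α hk]
      rw [neg_pow (x ^ k), ← pow_mul]
      push_cast
      ring
    · push_cast
      ring_nf
  · intro n hn
    have : ¬ k ∣ n := fun ⟨j, hj⟩ => hn ⟨j, hj.symm⟩
    rw [coeff_eulerFactor_of_not_dvd α hk this]
    simp

/-! ### The logarithm of the Euler product -/

/-- The function `G(s) = -∑_{k ≥ 1} log (1 - e ^ (-k s))` on the half-plane `Re s > 0`, the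
logarithm of the partition generating function at `e ^ (-s)`. -/
noncomputable def logEuler (s : ℂ) : ℂ :=
  ∑' k : ℕ, -Complex.log (1 - Complex.exp (-s) ^ (k + 1))

theorem norm_log_one_sub_le {z : ℂ} (hz : ‖z‖ < 1) : ‖Complex.log (1 - z)‖ ≤ ‖z‖ / (1 - ‖z‖) := by
  have h := Complex.norm_log_one_add_le (z := -z) (by rwa [norm_neg])
  rw [norm_neg, ← sub_eq_add_neg] at h
  refine h.trans ?_
  have h1 : 0 < 1 - ‖z‖ := sub_pos.mpr hz
  have h0 := norm_nonneg z
  rw [le_div_iff₀ h1]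
  field_simp
  nlinarith

theorem norm_log_one_sub_pow_le {x : ℂ} {q : ℝ} (hxq : ‖x‖ ≤ q) (hq : q < 1) (k : ℕ) :
    ‖-Complex.log (1 - x ^ (k + 1))‖ ≤ q ^ (k + 1) / (1 - q) := by
  have hx0 := norm_nonneg x
  have h0 : ‖x ^ (k + 1)‖ ≤ q ^ (k + 1) := by
    rw [norm_pow]
    exact pow_le_pow_left₀ hx0 hxq _
  have h1 : q ^ (k + 1) ≤ q := pow_le_of_le_one (hx0.trans hxq) hq.le (by omega)
  rw [norm_neg]
  refine (norm_log_one_sub_le (by linarith)).trans ?_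
  have h2 : 0 ≤ q := hx0.trans hxq
  gcongr
  linarith

theorem hasSum_pow_succ_div {q : ℝ} (h0 : 0 ≤ q) (hq : q < 1) :
    HasSum (fun k : ℕ => q ^ (k + 1) / (1 - q)) (q / (1 - q) ^ 2) := by
  have := ((hasSum_geometric_of_lt_one h0 hq).mul_left q).div_const (1 - q)
  have hne : 1 - q ≠ 0 := by linarith
  simp_rw [← pow_succ'] at this
  rwa [show q * (1 - q)⁻¹ / (1 - q) = q / (1 - q) ^ 2 by field_simp] at this

theorem norm_exp_neg (s : ℂ) : ‖Complex.exp (-s)‖ = Real.exp (-s.re) := by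
  rw [Complex.norm_exp, Complex.neg_re]

theorem norm_exp_neg_lt_one {s : ℂ} (hs : 0 < s.re) : ‖Complex.exp (-s)‖ < 1 := by
  rw [norm_exp_neg, Real.exp_lt_one_iff]
  linarith

theorem summable_logEuler {s : ℂ} (hs : 0 < s.re) :
    Summable fun k : ℕ => -Complex.log (1 - Complex.exp (-s) ^ (k + 1)) :=
  Summable.of_norm_bounded
    (hasSum_pow_succ_div (norm_nonneg _) (norm_exp_neg_lt_one hs)).summable
    (norm_log_one_sub_pow_le le_rfl (norm_exp_neg_lt_one hs))

theorem norm_logEuler_le {s : ℂ} (hs : 0 < s.re) :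
    ‖logEuler s‖ ≤ Real.exp (-s.re) / (1 - Real.exp (-s.re)) ^ 2 := by
  rw [← norm_exp_neg]
  exact tsum_of_norm_bounded (hasSum_pow_succ_div (norm_nonneg _) (norm_exp_neg_lt_one hs))
    (norm_log_one_sub_pow_le le_rfl (norm_exp_neg_lt_one hs))

theorem continuousOn_logEuler : ContinuousOn logEuler {s | 0 < s.re} := by
  intro s hs
  refine ContinuousAt.continuousWithinAt ?_
  have hs' : (0 : ℝ) < s.re := hs
  -- On `Re z > Re s / 2` the series is dominated by a fixed geometric series.
  have hq1 : Real.exp (-(s.re / 2)) < 1 := Real.exp_lt_one_iff.mpr (by linarith)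
  have hopen : IsOpen {z : ℂ | s.re / 2 < z.re} := isOpen_lt continuous_const Complex.continuous_re
  have hle : ∀ z ∈ {z : ℂ | s.re / 2 < z.re}, ‖Complex.exp (-z)‖ ≤ Real.exp (-(s.re / 2)) := by
    intro z hz
    rw [norm_exp_neg, Real.exp_le_exp]
    have : s.re / 2 < z.re := hz
    linarith
  have hc : ContinuousOn logEuler {z : ℂ | s.re / 2 < z.re} := by
    refine continuousOn_tsum (fun k => ?_)
      (hasSum_pow_succ_div (Real.exp_pos _).le hq1).summable
      fun k z hz => norm_log_one_sub_pow_le (hle z hz) hq1 k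
    refine (ContinuousOn.clog (by fun_prop) fun z hz => ?_).neg
    refine Complex.mem_slitPlane_of_norm_lt_one (z := -Complex.exp (-z) ^ (k + 1)) ?_
    rw [norm_neg, norm_pow]
    exact pow_lt_one₀ (norm_nonneg _) ((hle z hz).trans_lt hq1) (by omega)
  exact hc.continuousAt (hopen.mem_nhds (show s.re / 2 < s.re by linarith))

/-! ### The coefficient integral -/

theorem integral_exp_int_mul_I (m : ℤ) :
    ∫ θ in (-Real.pi)..Real.pi, Complex.exp (m * (θ * Complex.I)) =
      if m = 0 then 2 * (Real.pi : ℂ) else 0 := by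
  split_ifs with h
  · subst h
    simp
    ring
  · have hc : (m : ℂ) * Complex.I ≠ 0 := mul_ne_zero (by exact_mod_cast h) Complex.I_ne_zero
    have h1 : ∀ θ : ℝ, Complex.exp (m * (θ * Complex.I)) = Complex.exp (m * Complex.I * θ) :=
      fun θ => by ring_nf
    simp_rw [h1]
    rw [integral_exp_mul_complex hc]
    have h2 : Complex.exp (m * Complex.I * (Real.pi : ℝ)) =
        Complex.exp (m * Complex.I * ((-Real.pi : ℝ) : ℂ)) := by
      rw [Complex.exp_eq_exp_iff_exists_int]
      exact ⟨m, by push_cast; ring⟩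
    rw [h2, sub_self, zero_div]

/-- Cauchy's formula on the circle of radius `e ^ (-t)`. -/
theorem HasDiscSum.integral_eq {p : ℝ⟦X⟧} {f : ℂ → ℂ} (h : HasDiscSum p f) {t : ℝ} (ht : 0 < t)
    (n : ℕ) :
    ∫ θ in (-Real.pi)..Real.pi, f (Complex.exp (-(t + θ * Complex.I))) *
      Complex.exp (n * (t + θ * Complex.I)) = 2 * Real.pi * ((PowerSeries.coeff n p : ℝ) : ℂ) := by
  have hre : ∀ θ : ℝ, ((t : ℂ) + θ * Complex.I).re = t := fun θ => by simp
  have hlt : ∀ θ : ℝ, ‖Complex.exp (-(t + θ * Complex.I))‖ < 1 := fun θ =>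
    norm_exp_neg_lt_one (by rwa [hre])
  have hsum : Summable fun m : ℕ =>
      ‖((PowerSeries.coeff m p : ℝ) : ℂ)‖ * Real.exp (-t) ^ m * Real.exp (n * t) := by
    have h1 := (h (Real.exp (-t)) (by
      rw [Complex.norm_real, Real.norm_of_nonneg (Real.exp_pos _).le, Real.exp_lt_one_iff]
      linarith)).summable.norm.mul_right (Real.exp (n * t))
    simpa only [norm_mul, norm_pow, Complex.norm_real, Real.norm_eq_abs,
      abs_of_pos (Real.exp_pos _)] using h1
  have key := intervalIntegral.hasSum_integral_of_dominated_convergence (a := -Real.pi)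
    (b := Real.pi) (μ := volume)
    (F := fun (m : ℕ) (θ : ℝ) => ((PowerSeries.coeff m p : ℝ) : ℂ) *
      Complex.exp (-(t + θ * Complex.I)) ^ m * Complex.exp (n * (t + θ * Complex.I)))
    (f := fun θ : ℝ => f (Complex.exp (-(t + θ * Complex.I))) *
      Complex.exp (n * (t + θ * Complex.I)))
    (fun m _ => ‖((PowerSeries.coeff m p : ℝ) : ℂ)‖ * Real.exp (-t) ^ m * Real.exp (n * t))
    (fun m => by
      refine Continuous.aestronglyMeasurable ?_
      fun_prop)
    (fun m => .of_forall fun θ _ => by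
      rw [norm_mul, norm_mul, norm_pow, norm_exp_neg, hre, Complex.norm_exp]
      simp)
    (.of_forall fun _ _ => hsum)
    intervalIntegrable_const
    (.of_forall fun θ _ => (h _ (hlt θ)).mul_right _)
  refine key.unique ?_
  have hterm : ∀ m : ℕ, (∫ θ in (-Real.pi)..Real.pi, ((PowerSeries.coeff m p : ℝ) : ℂ) *
      Complex.exp (-(t + θ * Complex.I)) ^ m * Complex.exp (n * (t + θ * Complex.I))) =
      ((PowerSeries.coeff m p : ℝ) : ℂ) * Complex.exp ((n - m) * t) *
        if ((n : ℤ) - m : ℤ) = 0 then 2 * (Real.pi : ℂ) else 0 := fun m => by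
    rw [← integral_exp_int_mul_I, ← intervalIntegral.integral_const_mul]
    refine intervalIntegral.integral_congr fun θ _ => ?_
    simp only [← Complex.exp_nat_mul]
    rw [mul_assoc, mul_assoc, ← Complex.exp_add, ← Complex.exp_add]
    push_cast
    ring_nf
  rw [funext hterm]
  convert hasSum_single n ?_ using 1
  · simp
    ring
  · intro m hm
    rw [if_neg, mul_zero]
    omega

theorem tendsto_coeff_prod_eulerFactor (α : ℝ) (n : ℕ) :
    Tendsto (fun N => PowerSeries.coeff n (∏ k ∈ Finset.range N, eulerFactor α (k + 1))) atTop
      (𝓝 (fracPartition α n)) := by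
  open scoped PowerSeries.WithPiTopology in
  exact ((PowerSeries.WithPiTopology.continuous_coeff ℝ n).tendsto _).comp
    (multipliable_eulerFactor α).hasProd.tendsto_prod_nat

/-- The coefficients of the infinite product as Fourier integrals over `Re s = t`, by passing to
the limit in Cauchy's formula for the finite products. -/
theorem integral_exp_logEuler (α : ℝ) {t : ℝ} (ht : 0 < t) (n : ℕ) :
    ∫ θ in (-Real.pi)..Real.pi, Complex.exp (α * logEuler (t + θ * Complex.I) +
      n * (t + θ * Complex.I)) = 2 * Real.pi * (fracPartition α n : ℂ) := by
  have hre : ∀ θ : ℝ, ((t : ℂ) + θ * Complex.I).re = t := fun θ => by simp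
  have hs : ∀ θ : ℝ, 0 < ((t : ℂ) + θ * Complex.I).re := fun θ => by rwa [hre]
  set q : ℝ := Real.exp (-t) with hq
  have hq1 : q < 1 := Real.exp_lt_one_iff.mpr (by linarith)
  have hfin : ∀ N, ∫ θ in (-Real.pi)..Real.pi, Complex.exp (∑ k ∈ Finset.range N,
      (α * -Complex.log (1 - Complex.exp (-(t + θ * Complex.I)) ^ (k + 1))) +
      n * (t + θ * Complex.I)) = 2 * Real.pi *
        ((PowerSeries.coeff n (∏ k ∈ Finset.range N, eulerFactor α (k + 1)) : ℝ) : ℂ) := fun N => by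
    rw [← (HasDiscSum.prod (fun k => hasDiscSum_eulerFactor α k.succ_ne_zero) N).integral_eq ht n]
    simp_rw [Complex.exp_add, Complex.exp_sum]
  have hlim : Tendsto (fun N => 2 * Real.pi *
      ((PowerSeries.coeff n (∏ k ∈ Finset.range N, eulerFactor α (k + 1)) : ℝ) : ℂ)) atTop
      (𝓝 (2 * Real.pi * (fracPartition α n : ℂ))) :=
    ((Complex.continuous_ofReal.tendsto _).comp
      (tendsto_coeff_prod_eulerFactor α n)).const_mul _
  refine tendsto_nhds_unique ?_ hlim
  simp_rw [← hfin]
  refine intervalIntegral.tendsto_integral_filter_of_dominated_convergence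
    (fun _ => Real.exp (|α| * (q / (1 - q) ^ 2) + n * t)) ?_ ?_ intervalIntegrable_const ?_
  · refine .of_forall fun N => Measurable.aestronglyMeasurable ?_
    fun_prop
  · refine .of_forall fun N => .of_forall fun θ _ => ?_
    rw [Complex.norm_exp, Real.exp_le_exp, Complex.add_re]
    refine add_le_add ((Complex.re_le_norm _).trans ?_) (by simp)
    rw [← Finset.mul_sum, norm_mul, Complex.norm_real, Real.norm_eq_abs]
    gcongr
    have hb : ∀ k, ‖-Complex.log (1 - Complex.exp (-(t + θ * Complex.I)) ^ (k + 1))‖ ≤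
        q ^ (k + 1) / (1 - q) :=
      norm_log_one_sub_pow_le (by rw [norm_exp_neg, hre]) hq1
    refine (norm_sum_le_of_le _ fun k _ => hb k).trans ?_
    have hS := hasSum_pow_succ_div (Real.exp_pos (-t)).le hq1
    exact sum_le_hasSum _ (fun k _ => (norm_nonneg _).trans (hb k)) hS
  · refine .of_forall fun θ _ => (Complex.continuous_exp.tendsto _).comp ?_
    refine Tendsto.add_const _ ?_
    simp_rw [← Finset.mul_sum]
    exact (summable_logEuler (hs θ)).hasSum.tendsto_sum_nat.const_mul _

/-! ### The modular transformation of the Euler product -/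

theorem exp_neg_logEuler {s : ℂ} (hs : 0 < s.re) :
    Complex.exp (-logEuler s) = ∏' k : ℕ, (1 - Complex.exp (-s) ^ (k + 1)) := by
  have h := (summable_logEuler hs).hasSum.neg.cexp
  rw [logEuler, ← h.tprod_eq]
  refine tprod_congr fun k => ?_
  have hk : ‖Complex.exp (-s) ^ (k + 1)‖ < 1 := by
    rw [norm_pow]
    exact pow_lt_one₀ (norm_nonneg _) (norm_exp_neg_lt_one hs) (by omega)
  simp [Complex.exp_log (one_sub_ne_zero_of_norm_lt_one hk)]

theorem eta_I_mul_div_two_pi {s : ℂ} (hs : 0 < s.re) :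
    ModularForm.eta (Complex.I * s / (2 * Real.pi)) =
      Complex.exp (-s / 24) * Complex.exp (-logEuler s) := by
  have hpi : (Real.pi : ℂ) ≠ 0 := by exact_mod_cast Real.pi_ne_zero
  have h1 : 2 * Real.pi * Complex.I * (Complex.I * s / (2 * Real.pi)) = -s := by
    field_simp
    rw [Complex.I_sq]
    ring
  rw [ModularForm.eta, exp_neg_logEuler hs]
  congr 1
  · rw [Function.Periodic.qParam, h1]
    norm_num
  · refine tprod_congr fun k => ?_
    rw [ModularForm.eta_q_eq_pow, h1]

theorem re_div_pos {s : ℂ} (hs : 0 < s.re) {a : ℝ} (ha : 0 < a) : 0 < ((a : ℂ) / s).re := by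
  have hs0 : s ≠ 0 := by
    rintro rfl
    simp at hs
  rw [div_eq_mul_inv, Complex.re_ofReal_mul, Complex.inv_re]
  exact mul_pos ha (div_pos hs (Complex.normSq_pos.mpr hs0))

/-- The difference of the two sides of the transformation formula of `logEuler`. -/
noncomputable def logEulerDefect (s : ℂ) : ℂ :=
  logEuler s - ((Real.pi ^ 2 / 6 : ℝ) / s + Complex.log (s / (2 * Real.pi : ℝ)) / 2 - s / 24 +
    logEuler ((4 * Real.pi ^ 2 : ℝ) / s))

/-- The square of the transformation formula of the eta function; squaring removes the choice of
a branch of the square root. -/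
theorem exp_two_mul_logEulerDefect {s : ℂ} (hs : 0 < s.re) :
    Complex.exp (2 * logEulerDefect s) = 1 := by
  have hpi : (Real.pi : ℂ) ≠ 0 := by exact_mod_cast Real.pi_ne_zero
  have hs0 : s ≠ 0 := by
    rintro rfl
    simp at hs
  set z : ℂ := Complex.I * s / (2 * Real.pi) with hz
  set s' : ℂ := (4 * Real.pi ^ 2 : ℝ) / s with hs'
  have hs're : 0 < s'.re := re_div_pos hs (by positivity)
  have hzim : 0 < z.im := by
    have : z = ((1 / (2 * Real.pi) : ℝ) : ℂ) * (s * Complex.I) := by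
      rw [hz]
      push_cast
      ring
    rw [this, Complex.im_ofReal_mul, Complex.mul_I_im]
    positivity
  have hz0 : z ≠ 0 := by
    rintro h
    simp [h] at hzim
  have hzz : -1 / z = Complex.I * s' / (2 * Real.pi) := by
    rw [hz, hs', div_eq_iff (by rw [← hz]; exact hz0)]
    push_cast
    field_simp
    rw [Complex.I_sq]
    ring
  have hsqrt : ∀ w : ℂ, w ≠ 0 → Complex.sqrt w ^ 2 = w := fun w hw => by
    rw [sqrt_eq_exp hw, ← Complex.exp_nat_mul]
    conv_rhs => rw [← Complex.exp_log hw]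
    congr 1
    push_cast
    ring
  have key := ModularForm.eta_comp_eq_csqrt_I_inv (show z ∈ UpperHalfPlane.upperHalfPlaneSet from hzim)
  simp only [Function.comp_apply, Pi.smul_apply, Pi.mul_apply, smul_eq_mul] at key
  rw [hzz, eta_I_mul_div_two_pi hs're, hz, eta_I_mul_div_two_pi hs, ← hz] at key
  have key2 := congrArg (· ^ 2) key
  simp only [mul_pow, inv_pow, hsqrt _ hz0, hsqrt _ Complex.I_ne_zero, ← Complex.exp_nat_mul] at key2
  have hlog : Complex.exp (Complex.log (s / (2 * Real.pi : ℝ))) = Complex.I⁻¹ * z := by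
    rw [Complex.exp_log (div_ne_zero hs0 (by simp)), hz]
    push_cast
    field_simp
  have hsplit : 2 * logEulerDefect s = (((2 : ℕ) : ℂ) * (-s' / 24) + (2 : ℕ) * (-logEuler s')) -
      (Complex.log (s / (2 * Real.pi : ℝ)) + ((2 : ℕ) * (-s / 24) + (2 : ℕ) * (-logEuler s))) := by
    have : (Real.pi ^ 2 / 6 : ℝ) / s = s' / 24 := by
      rw [hs']
      push_cast
      field_simp
      norm_num
    rw [logEulerDefect, ← hs', this]
    push_cast
    ring
  rw [hsplit, Complex.exp_sub, div_eq_one_iff_eq (Complex.exp_ne_zero _), Complex.exp_add,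
    Complex.exp_add, Complex.exp_add, hlog, key2]
  ring

theorem continuousOn_logEulerDefect : ContinuousOn logEulerDefect {s | 0 < s.re} := by
  have h0 : ∀ s ∈ {s : ℂ | 0 < s.re}, s ≠ 0 := by
    rintro s hs rfl
    simp at hs
  have hinv : ∀ a : ℂ, ContinuousOn (fun s : ℂ => a / s) {s | 0 < s.re} := fun a =>
    continuousOn_const.div continuousOn_id h0
  refine continuousOn_logEuler.sub ((((hinv _).add (ContinuousOn.div_const ?_ _)).sub
    (by fun_prop)).add (continuousOn_logEuler.comp (hinv _) fun s hs => re_div_pos hs (by positivity)))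
  refine ContinuousOn.clog (by fun_prop) fun s hs => Or.inl ?_
  rw [Complex.div_ofReal_re]
  exact div_pos hs (by positivity)

/-- The transformation formula of `logEuler` under `s ↦ 4π² / s`. The two sides are continuous,
differ by an element of `πiℤ`, and agree at the fixed point `s = 2π`. -/
theorem logEuler_eq {s : ℂ} (hs : 0 < s.re) :
    logEuler s = (Real.pi ^ 2 / 6 : ℝ) / s + Complex.log (s / (2 * Real.pi : ℝ)) / 2 - s / 24 +
      logEuler ((4 * Real.pi ^ 2 : ℝ) / s) := by
  have hpi : (Real.pi : ℂ) ≠ 0 := by exact_mod_cast Real.pi_ne_zero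
  have hS : IsPreconnected {s : ℂ | 0 < s.re} := (convex_halfSpace_re_gt 0).isPreconnected
  have hdisc : IsDiscrete (Set.range ((↑) : ℤ → ℝ)) := by
    simpa using Int.isClosedEmbedding_coe_real.isEmbedding.isInducing.isDiscrete_range
  have hexp : ∀ s ∈ {s : ℂ | 0 < s.re}, ∃ n : ℤ, logEulerDefect s = n * (Real.pi * Complex.I) := by
    intro s hs
    obtain ⟨n, hn⟩ := Complex.exp_eq_one_iff.mp (exp_two_mul_logEulerDefect hs)
    exact ⟨n, by linear_combination hn / 2⟩
  have hdiv : ∀ n : ℤ, ((n : ℂ) * (Real.pi * Complex.I) / (Real.pi * Complex.I)).re = n := fun n => by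
    rw [mul_div_cancel_right₀ _ (mul_ne_zero hpi Complex.I_ne_zero)]
    simp
  have hmaps : Set.MapsTo (fun s => (logEulerDefect s / (Real.pi * Complex.I)).re)
      {s : ℂ | 0 < s.re} (Set.range ((↑) : ℤ → ℝ)) := by
    intro s hs
    obtain ⟨n, hn⟩ := hexp s hs
    exact ⟨n, by simp only [hn, hdiv]⟩
  have hcont : ContinuousOn (fun s => (logEulerDefect s / (Real.pi * Complex.I)).re)
      {s : ℂ | 0 < s.re} :=
    Complex.continuous_re.comp_continuousOn (continuousOn_logEulerDefect.div_const _)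
  have h2pi : (((2 * Real.pi : ℝ) : ℂ)) ∈ {s : ℂ | 0 < s.re} := by
    rw [Set.mem_ofPred_eq, Complex.ofReal_re]
    positivity
  have hfix : logEulerDefect ((2 * Real.pi : ℝ) : ℂ) = 0 := by
    have h1 : ((4 * Real.pi ^ 2 : ℝ) : ℂ) / ((2 * Real.pi : ℝ) : ℂ) = ((2 * Real.pi : ℝ) : ℂ) := by
      push_cast
      field_simp
      norm_num
    have h2 : ((2 * Real.pi : ℝ) : ℂ) / ((2 * Real.pi : ℝ) : ℂ) = 1 := by
      push_cast
      field_simp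
    rw [logEulerDefect, h1, h2, Complex.log_one]
    push_cast
    field_simp
    ring
  have hconst := hS.constant_of_mapsTo hdisc hcont hmaps hs h2pi
  obtain ⟨n, hn⟩ := hexp s hs
  simp only [hn, hdiv, hfix, zero_div, Complex.zero_re] at hconst
  rw [Int.cast_eq_zero.mp hconst] at hn
  rw [← sub_eq_zero]
  simpa [logEulerDefect] using hn

/-! ### Decay away from the real axis -/

/-- Every term of the power series of `-log (1 - x)` has its largest real part at `|x|`; the first
term alone gives this gap. -/
theorem re_neg_log_one_sub_le {x : ℂ} (hx : ‖x‖ < 1) :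
    (-Complex.log (1 - x)).re ≤ -Real.log (1 - ‖x‖) - (‖x‖ - x.re) := by
  have h1 := Complex.hasSum_re (Complex.hasSum_taylorSeries_neg_log hx)
  have h2 : HasSum (fun n : ℕ => ‖x‖ ^ n / n) (-Real.log (1 - ‖x‖)) := by
    have h := Complex.hasSum_re (Complex.hasSum_taylorSeries_neg_log
      (z := (‖x‖ : ℂ)) (by simpa using hx))
    have e1 : ∀ n : ℕ, ((‖x‖ : ℂ) ^ n / n).re = ‖x‖ ^ n / n := fun n => by
      rw [← Complex.ofReal_natCast, ← Complex.ofReal_pow, ← Complex.ofReal_div, Complex.ofReal_re]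
    have e2 : (-Complex.log (1 - (‖x‖ : ℂ))).re = -Real.log (1 - ‖x‖) := by
      rw [← Complex.ofReal_one, ← Complex.ofReal_sub, Complex.neg_re, Complex.log_ofReal_re]
    rw [← e2]
    simpa only [e1] using h
  have h3 := h2.sub h1
  have h4 : ∀ n : ℕ, 0 ≤ ‖x‖ ^ n / n - (x ^ n / n).re := fun n => by
    rw [sub_nonneg]
    refine (Complex.re_le_norm _).trans ?_
    simp
  have h5 := le_hasSum h3 1 fun n _ => h4 n
  simp only [pow_one, Nat.cast_one, div_one] at h5
  linarith

/-- `Re G(s)` compared with `G(Re s)`: the first terms of the logarithms sum to geometric series. -/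
theorem re_logEuler_le {s : ℂ} (hs : 0 < s.re) :
    (logEuler s).re ≤ (logEuler s.re).re -
      (Real.exp (-s.re) / (1 - Real.exp (-s.re)) -
        (Complex.exp (-s) / (1 - Complex.exp (-s))).re) := by
  set x := Complex.exp (-s) with hx
  set q := Real.exp (-s.re) with hq
  have hxq : ‖x‖ = q := norm_exp_neg s
  have hx1 : ‖x‖ < 1 := norm_exp_neg_lt_one hs
  have hq0 : 0 ≤ q := (Real.exp_pos _).le
  have hq1 : q < 1 := hxq ▸ hx1
  have hxe : Complex.exp (-(s.re : ℂ)) = q := by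
    rw [hq]
    push_cast
    rfl
  have h1 := Complex.hasSum_re (summable_logEuler hs).hasSum
  have h2 := Complex.hasSum_re (summable_logEuler (s := s.re) (by simpa using hs)).hasSum
  have h3 : HasSum (fun k : ℕ => q ^ (k + 1)) (q / (1 - q)) := by
    simpa only [← pow_succ', div_eq_mul_inv] using (hasSum_geometric_of_lt_one hq0 hq1).mul_left q
  have h4 : HasSum (fun k : ℕ => (x ^ (k + 1)).re) (x / (1 - x)).re := by
    refine Complex.hasSum_re ?_
    simpa only [← pow_succ', div_eq_mul_inv] using (hasSum_geometric_of_norm_lt_one hx1).mul_left x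
  refine hasSum_le (fun k => ?_) h1 (h2.sub (h3.sub h4))
  have hxk : ‖x ^ (k + 1)‖ = q ^ (k + 1) := by rw [norm_pow, hxq]
  have hqk : q ^ (k + 1) < 1 := pow_lt_one₀ hq0 hq1 (by omega)
  have h5 := re_neg_log_one_sub_le (x := x ^ (k + 1)) (by rwa [hxk])
  rw [hxk] at h5
  have h6 : (-Complex.log (1 - (q : ℂ) ^ (k + 1))).re = -Real.log (1 - q ^ (k + 1)) := by
    rw [← Complex.ofReal_one, ← Complex.ofReal_pow, ← Complex.ofReal_sub, Complex.neg_re,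
      Complex.log_ofReal_re]
  rwa [hxe, h6]

/-- A lower bound for the distance to `1` on the circle of radius `q = e ^ (-t)`: with
`1 - cos θ ≥ 2 θ² / π²`, `|θ| ≥ t ≥ 1 - q` and `q ≥ 1 / 2`, its square is at least
`(6 / 5) (1 - q)²`, and `(21 / 20)² ≤ 6 / 5`. -/
theorem norm_one_sub_exp_ge {t θ : ℝ} (ht : 0 < t) (hθ : |θ| ≤ Real.pi) (htθ : t ≤ |θ|)
    (hq : 1 / 2 ≤ Real.exp (-t)) :
    (1 - Real.exp (-t)) * (21 / 20) ≤ ‖1 - Complex.exp (-(t + θ * Complex.I))‖ := by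
  set q := Real.exp (-t) with hqd
  have hq1 : q < 1 := Real.exp_lt_one_iff.mpr (by linarith)
  have hx : Complex.exp (-(t + θ * Complex.I)) =
      ((q * Real.cos θ : ℝ) : ℂ) - ((q * Real.sin θ : ℝ) : ℂ) * Complex.I := by
    rw [neg_add, Complex.exp_add, ← neg_mul, Complex.exp_mul_I, hqd]
    push_cast
    rw [Complex.cos_neg, Complex.sin_neg]
    ring
  have hn : ‖1 - Complex.exp (-(t + θ * Complex.I))‖ ^ 2 =
      (1 - q) ^ 2 + 2 * q * (1 - Real.cos θ) := by
    rw [hx, ← Complex.normSq_eq_norm_sq, Complex.normSq_apply]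
    simp [-Complex.ofReal_cos, -Complex.ofReal_sin]
    linear_combination q ^ 2 * Real.sin_sq_add_cos_sq θ
  have hcos : Real.cos θ ≤ 1 - 2 / Real.pi ^ 2 * θ ^ 2 := Real.cos_le_one_sub_mul_cos_sq hθ
  have hqt : 1 - q ≤ t := by
    have := Real.add_one_le_exp (-t)
    linarith
  have hpi : Real.pi ^ 2 < 10 := by nlinarith [Real.pi_lt_d2, Real.pi_pos]
  have hpi2 : 1 / 10 < 1 / Real.pi ^ 2 := one_div_lt_one_div_of_lt (by positivity) hpi
  have hθ2 : (1 - q) ^ 2 ≤ θ ^ 2 := by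
    rw [← sq_abs θ]
    exact pow_le_pow_left₀ (by linarith) (hqt.trans htθ) 2
  have h2 : 1 / 5 * (1 - q) ^ 2 ≤ 2 * q * (1 - Real.cos θ) := by
    have : 1 / 5 * (1 - q) ^ 2 ≤ 1 - Real.cos θ := by
      have : 2 / Real.pi ^ 2 * θ ^ 2 = 2 * (1 / Real.pi ^ 2) * θ ^ 2 := by ring
      nlinarith [sq_nonneg θ]
    have h0 : 0 ≤ 1 - Real.cos θ := by linarith [Real.cos_le_one θ]
    nlinarith
  refine le_of_sq_le_sq ?_ (norm_nonneg _)
  rw [hn]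
  nlinarith [sq_nonneg (1 - q)]

/-- The gap of `Re G` away from the real axis. Only its order `1 / t` matters. -/
theorem re_logEuler_le_sub {t θ : ℝ} (ht : 0 < t) (hθ : |θ| ≤ Real.pi) (htθ : t ≤ |θ|)
    (hq : 1 / 2 ≤ Real.exp (-t)) :
    (logEuler (t + θ * Complex.I)).re ≤ (logEuler t).re - 1 / (42 * t) := by
  have hre : ((t : ℂ) + θ * Complex.I).re = t := by simp
  have h := re_logEuler_le (s := t + θ * Complex.I) (by rwa [hre])
  have hn := norm_one_sub_exp_ge ht hθ htθ hq
  have hxn := norm_exp_neg (t + θ * Complex.I)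
  rw [hre] at h hxn
  set x := Complex.exp (-(t + θ * Complex.I))
  set q := Real.exp (-t)
  have hq1 : q < 1 := Real.exp_lt_one_iff.mpr (by linarith)
  have hqt : 1 - q ≤ t := by
    have := Real.add_one_le_exp (-t)
    linarith
  have hd : 0 < 1 - q := by linarith
  have h1 : (x / (1 - x)).re ≤ q / ((1 - q) * (21 / 20)) := by
    refine (Complex.re_le_norm _).trans ?_
    rw [norm_div, hxn]
    gcongr
  have h2 : 1 / (42 * t) ≤ q / (1 - q) - q / ((1 - q) * (21 / 20)) := by
    have : q / (1 - q) - q / ((1 - q) * (21 / 20)) = q / (21 * (1 - q)) := by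
      field_simp
      ring
    rw [this, div_le_div_iff₀ (by positivity) (by positivity)]
    nlinarith
  linarith

/-! ### The saddle point -/

theorem tendsto_logEuler_comap_re_atTop : Tendsto logEuler (comap Complex.re atTop) (𝓝 0) := by
  have h1 : Tendsto (fun s : ℂ => Real.exp (-s.re)) (comap Complex.re atTop) (𝓝 0) :=
    (Real.tendsto_exp_atBot.comp tendsto_neg_atTop_atBot).comp tendsto_comap
  have h2 : Tendsto (fun s : ℂ => Real.exp (-s.re) / (1 - Real.exp (-s.re)) ^ 2)
      (comap Complex.re atTop) (𝓝 0) := by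
    have h := h1.div ((h1.const_sub 1).pow 2) (by norm_num)
    rw [zero_div] at h
    exact h
  refine squeeze_zero_norm' ?_ h2
  filter_upwards [tendsto_comap.eventually (eventually_gt_atTop 0)] with s hs
  exact norm_logEuler_le hs

/-- The integrand of the coefficient integral at height `s = (2π / l) (1 + iu)`, divided by its
main term `e ^ (παl / 6) * l ^ (-α / 2)`. -/
noncomputable def saddleKernel (α l u : ℝ) : ℂ :=
  Complex.exp (((Real.pi * α / 12 * l : ℝ) : ℂ) * (-(u : ℂ) ^ 2 / (1 + u * Complex.I)) +
    α / 2 * Complex.log (1 + u * Complex.I) +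
    α * logEuler ((2 * Real.pi * l : ℝ) / (1 + u * Complex.I)))

theorem one_add_mul_I_re (u : ℝ) : (1 + u * Complex.I : ℂ).re = 1 := by simp

theorem one_add_mul_I_ne_zero (u : ℝ) : (1 + u * Complex.I : ℂ) ≠ 0 := fun h => by
  have := one_add_mul_I_re u
  rw [h] at this
  simp at this

theorem ofReal_div_one_add_mul_I_re (a u : ℝ) :
    ((a : ℂ) / (1 + u * Complex.I)).re = a / (1 + u ^ 2) := by
  rw [div_eq_mul_inv, Complex.re_ofReal_mul, Complex.inv_re, one_add_mul_I_re,
    Complex.normSq_apply]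
  simp
  ring

theorem continuous_saddleKernel (α : ℝ) {l : ℝ} (hl : 0 < l) : Continuous (saddleKernel α l) := by
  have h1 : Continuous fun u : ℝ => (1 + u * Complex.I : ℂ) := by fun_prop
  have h2 : Continuous fun u : ℝ => Complex.log (1 + u * Complex.I) :=
    h1.clog fun u => Or.inl (by simp)
  have h3 : Continuous fun u : ℝ => logEuler ((2 * Real.pi * l : ℝ) / (1 + u * Complex.I)) :=
    continuousOn_logEuler.comp_continuous (continuous_const.div h1 one_add_mul_I_ne_zero)
      fun u => re_div_pos (by simp) (by positivity)
  have h4 : Continuous fun u : ℝ => -(u : ℂ) ^ 2 / (1 + u * Complex.I) :=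
    Continuous.div (by fun_prop) h1 one_add_mul_I_ne_zero
  unfold saddleKernel
  fun_prop

/-- The transformation formula turns the exponent of the coefficient integral into
`(παl / 12) (w + 1 / w) + (α / 2) log (w / l) + α G(2πl / w)`, where `w = 1 + iu`. -/
theorem exp_logEuler_eq_saddleKernel (α : ℝ) {l : ℝ} (hl : 0 < l) (u : ℝ) :
    Complex.exp (α * logEuler ((2 * Real.pi / l : ℝ) + (2 * Real.pi / l * u : ℝ) * Complex.I) +
      (α * (1 + l ^ 2) / 24 : ℝ) *
        ((2 * Real.pi / l : ℝ) + (2 * Real.pi / l * u : ℝ) * Complex.I)) =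
    ((Real.exp (α * Real.pi / 6 * l) * l ^ (-(α / 2)) : ℝ) : ℂ) * saddleKernel α l u := by
  have hpi : (Real.pi : ℂ) ≠ 0 := by exact_mod_cast Real.pi_ne_zero
  have hl0 : (l : ℂ) ≠ 0 := by exact_mod_cast hl.ne'
  have hw0 := one_add_mul_I_ne_zero u
  set w : ℂ := 1 + u * Complex.I with hw
  have hs : ((2 * Real.pi / l : ℝ) : ℂ) + (2 * Real.pi / l * u : ℝ) * Complex.I =
      ((2 * Real.pi / l : ℝ) : ℂ) * w := by
    rw [hw]
    push_cast
    ring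
  have hsre : 0 < (((2 * Real.pi / l : ℝ) : ℂ) * w).re := by
    rw [Complex.re_ofReal_mul, hw, one_add_mul_I_re, mul_one]
    positivity
  have e1 : ((2 * Real.pi / l : ℝ) : ℂ) * w / (2 * Real.pi : ℝ) = ((l⁻¹ : ℝ) : ℂ) * w := by
    push_cast
    field_simp
  have e2 : ((4 * Real.pi ^ 2 : ℝ) : ℂ) / (((2 * Real.pi / l : ℝ) : ℂ) * w) =
      (2 * Real.pi * l : ℝ) / w := by
    push_cast
    field_simp
    norm_num
  have e3 : u ^ 2 = -(w - 1) ^ 2 := by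
    rw [hw, add_sub_cancel_left, mul_pow, Complex.I_sq]
    ring
  rw [hs, logEuler_eq hsre, e1, e2, Complex.log_ofReal_mul (inv_pos.mpr hl) hw0, Real.log_inv,
    Real.rpow_def_of_pos hl, ← Real.exp_add, Complex.ofReal_exp, saddleKernel, ← Complex.exp_add,
    ← hw, e3]
  congr 1
  push_cast
  field_simp
  ring

theorem eventually_norm_saddleKernel_le {α : ℝ} (hα : 0 < α) : ∀ᶠ l in atTop, ∀ u : ℝ, |u| ≤ 1 →
    ‖saddleKernel α l u‖ ≤
      Real.exp (α / 2 * Real.log 2 + α) * Real.exp (-(1 / 2) * (Real.pi * α / 12 * l * u ^ 2)) := by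
  have h1 : ∀ᶠ s in comap Complex.re atTop, ‖logEuler s‖ ≤ 1 := by
    have := tendsto_logEuler_comap_re_atTop.norm
    rw [norm_zero] at this
    exact this.eventually_le_const one_pos
  obtain ⟨R, hR⟩ := eventually_atTop.mp (eventually_comap.mp h1)
  filter_upwards [eventually_ge_atTop (R / Real.pi), eventually_gt_atTop 0] with l hl hl0 u hu
  have hu2 : u ^ 2 ≤ 1 := (sq_le_one_iff_abs_le_one u).mpr hu
  have hG : ‖logEuler ((2 * Real.pi * l : ℝ) / (1 + u * Complex.I))‖ ≤ 1 := by
    refine hR _ ?_ _ rfl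
    rw [ofReal_div_one_add_mul_I_re, le_div_iff₀ (by positivity)]
    rw [div_le_iff₀ Real.pi_pos] at hl
    have : 0 < Real.pi * l := by positivity
    nlinarith [sq_nonneg u]
  have hlog : (Complex.log (1 + u * Complex.I)).re ≤ Real.log 2 := by
    rw [Complex.log_re]
    refine Real.log_le_log (norm_pos_iff.mpr (one_add_mul_I_ne_zero u)) ?_
    refine (norm_add_le _ _).trans ?_
    rw [norm_mul, Complex.norm_I, Complex.norm_real, Real.norm_eq_abs, norm_one]
    linarith
  have hq : (-(u : ℂ) ^ 2 / (1 + u * Complex.I)).re ≤ -(1 / 2) * u ^ 2 := by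
    have : (-(u : ℂ) ^ 2 / (1 + u * Complex.I)) = ((-u ^ 2 : ℝ) : ℂ) / (1 + u * Complex.I) := by
      push_cast
      rfl
    rw [this, ofReal_div_one_add_mul_I_re, div_le_iff₀ (by positivity)]
    nlinarith [sq_nonneg u]
  rw [saddleKernel, Complex.norm_exp, ← Real.exp_add, Real.exp_le_exp, Complex.add_re,
    Complex.add_re, Complex.re_ofReal_mul, Complex.re_ofReal_mul]
  have e : ((α : ℂ) / 2 * Complex.log (1 + u * Complex.I)).re =
      α / 2 * (Complex.log (1 + u * Complex.I)).re := by
    rw [← Complex.re_ofReal_mul]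
    push_cast
    rfl
  rw [e]
  have h2 := (Complex.re_le_norm _).trans hG
  have h3 : Real.pi * α / 12 * l * (-(u : ℂ) ^ 2 / (1 + u * Complex.I)).re ≤
      Real.pi * α / 12 * l * (-(1 / 2) * u ^ 2) :=
    mul_le_mul_of_nonneg_left hq (by positivity)
  have h4 := mul_le_mul_of_nonneg_left hlog (show 0 ≤ α / 2 by positivity)
  have h5 := mul_le_mul_of_nonneg_left h2 hα.le
  linarith

/-- Laplace's method: after the substitution `u = v / √(παl / 12)` the integrand converges to
`e ^ (-v ^ 2)` and is dominated by a multiple of `e ^ (-v ^ 2 / 2)`. -/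
theorem tendsto_integral_saddleKernel {α : ℝ} (hα : 0 < α) :
    Tendsto (fun l : ℝ => (√(Real.pi * α / 12 * l) : ℂ) * ∫ u in (-1 : ℝ)..1, saddleKernel α l u)
      atTop (𝓝 (√Real.pi : ℝ)) := by
  set r : ℝ → ℝ := fun l => √(Real.pi * α / 12 * l) with hr
  have hc : 0 < Real.pi * α / 12 := by positivity
  have hrtop : Tendsto r atTop atTop :=
    Real.tendsto_sqrt_atTop.comp (tendsto_id.const_mul_atTop hc)
  have hr2 : ∀ l, 0 < l → r l ^ 2 = Real.pi * α / 12 * l := fun l hl => Real.sq_sqrt (by positivity)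
  have hrpos : ∀ l, 0 < l → 0 < r l := fun l hl => Real.sqrt_pos.mpr (by positivity)
  set F : ℝ → ℝ → ℂ := fun l => (Set.Ioc (-r l) (r l)).indicator fun v => saddleKernel α l (v / r l)
    with hF
  have hint : ∀ᶠ l in atTop, (r l : ℂ) * ∫ u in (-1 : ℝ)..1, saddleKernel α l u = ∫ v, F l v := by
    filter_upwards [eventually_gt_atTop 0] with l hl
    have hrl := hrpos l hl
    rw [hF, integral_indicator measurableSet_Ioc,
      ← intervalIntegral.integral_of_le (by linarith), intervalIntegral.integral_comp_div _ hrl.ne',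
      neg_div, div_self hrl.ne', Complex.real_smul]
  have hgauss : ((√Real.pi : ℝ) : ℂ) = ∫ v : ℝ, Complex.exp (-(v : ℂ) ^ 2) := by
    have h := integral_gaussian 1
    rw [div_one] at h
    rw [← h, ← integral_complex_ofReal]
    congr 1
    funext v
    push_cast
    ring_nf
  rw [hgauss]
  refine Tendsto.congr' (EventuallyEq.symm hint) ?_
  refine tendsto_integral_filter_of_dominated_convergence
    (fun v => Real.exp (α / 2 * Real.log 2 + α) * Real.exp (-(1 / 2) * v ^ 2)) ?_ ?_
    ((integrable_exp_neg_mul_sq (by norm_num)).const_mul _) (.of_forall fun v => ?_)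
  · filter_upwards [eventually_gt_atTop 0] with l hl
    exact ((continuous_saddleKernel α hl).comp
      (continuous_id.div_const _)).aestronglyMeasurable.indicator measurableSet_Ioc
  · filter_upwards [eventually_norm_saddleKernel_le hα, eventually_gt_atTop 0] with l hbound hl
    refine .of_forall fun v => ?_
    by_cases hv : v ∈ Set.Ioc (-r l) (r l)
    · simp only [hF, Set.indicator_of_mem hv]
      have hrl := hrpos l hl
      have h := hbound (v / r l) (by
        rw [abs_div, abs_of_pos hrl, div_le_one hrl, abs_le]
        exact ⟨hv.1.le, hv.2⟩)
      rwa [← hr2 l hl, ← mul_pow, mul_div_cancel₀ _ hrl.ne'] at h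
    · simp only [hF, Set.indicator_of_notMem hv, norm_zero]
      positivity
  · have hmem : ∀ᶠ l in atTop, F l v = saddleKernel α l (v / r l) := by
      filter_upwards [hrtop.eventually_gt_atTop |v|] with l hl
      refine Set.indicator_of_mem ?_ _
      have := abs_lt.mp hl
      exact ⟨this.1, this.2.le⟩
    have hu : Tendsto (fun l => v / r l) atTop (𝓝 0) := hrtop.const_div_atTop v
    have hw : Tendsto (fun l => (1 + (v / r l : ℝ) * Complex.I : ℂ)) atTop (𝓝 1) := by
      have := (((Complex.continuous_ofReal.tendsto 0).comp hu).mul_const Complex.I).const_add 1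
      simpa using this
    have h1 : Tendsto (fun l => -(v : ℂ) ^ 2 / (1 + (v / r l : ℝ) * Complex.I)) atTop
        (𝓝 (-(v : ℂ) ^ 2)) := by
      have h := (tendsto_const_nhds (x := -(v : ℂ) ^ 2)).div hw one_ne_zero
      rw [div_one] at h
      exact h
    have h2 : Tendsto (fun l => (α / 2 : ℂ) * Complex.log (1 + (v / r l : ℝ) * Complex.I)) atTop
        (𝓝 0) := by
      have := (hw.clog (by simp)).const_mul (α / 2 : ℂ)
      simpa using this
    have h3 : Tendsto (fun l => (α : ℂ) * logEuler ((2 * Real.pi * l : ℝ) /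
        (1 + (v / r l : ℝ) * Complex.I))) atTop (𝓝 0) := by
      rw [← mul_zero (α : ℂ)]
      refine (tendsto_logEuler_comap_re_atTop.comp (tendsto_comap_iff.mpr ?_)).const_mul _
      have h4 : Tendsto (fun l => (1 + (v / r l) ^ 2)⁻¹) atTop (𝓝 1) := by
        have := ((hu.pow 2).const_add 1).inv₀ (by norm_num)
        simpa using this
      have h5 : Tendsto (fun l : ℝ => 2 * Real.pi * l * (1 + (v / r l) ^ 2)⁻¹) atTop atTop :=
        (tendsto_id.const_mul_atTop (by positivity)).atTop_mul_pos one_pos h4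
      refine h5.congr fun l => ?_
      rw [Function.comp_apply, ofReal_div_one_add_mul_I_re]
      exact (div_eq_mul_inv _ _).symm
    have h6 := (Complex.continuous_exp.tendsto _).comp ((h1.add h2).add h3)
    rw [add_zero, add_zero] at h6
    refine h6.congr' ?_
    filter_upwards [hmem, eventually_gt_atTop 0] with l hl hl0
    rw [hl, saddleKernel, Function.comp_apply, ← hr2 l hl0]
    have hrl : (r l : ℂ) ≠ 0 := by exact_mod_cast (hrpos l hl0).ne'
    congr 3
    push_cast
    field_simp

/-! ### The asymptotics of the coefficients -/

/-- The integrand of the coefficient integral, with `n = α (1 + l ^ 2) / 24`, on the vertical line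
through the saddle point `2π / l`. -/
noncomputable def coeffIntegrand (α l θ : ℝ) : ℂ :=
  Complex.exp (α * logEuler ((2 * Real.pi / l : ℝ) + θ * Complex.I) +
    (α * (1 + l ^ 2) / 24 : ℝ) * ((2 * Real.pi / l : ℝ) + θ * Complex.I))

theorem continuous_coeffIntegrand (α : ℝ) {l : ℝ} (hl : 0 < l) : Continuous (coeffIntegrand α l) := by
  have h : Continuous fun θ : ℝ => logEuler ((2 * Real.pi / l : ℝ) + θ * Complex.I) :=
    continuousOn_logEuler.comp_continuous (by fun_prop) fun θ => by
      have : 0 < 2 * Real.pi / l := by positivity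
      simpa using this
  unfold coeffIntegrand
  fun_prop

theorem integral_coeffIntegrand_near (α : ℝ) {l : ℝ} (hl : 0 < l) :
    ∫ θ in (-(2 * Real.pi / l))..(2 * Real.pi / l), coeffIntegrand α l θ =
      ((2 * Real.pi / l * (Real.exp (α * Real.pi / 6 * l) * l ^ (-(α / 2))) : ℝ) : ℂ) *
        ∫ u in (-1 : ℝ)..1, saddleKernel α l u := by
  have ht : 0 < 2 * Real.pi / l := by positivity
  have h := intervalIntegral.integral_comp_mul_left (a := -1) (b := 1) (coeffIntegrand α l) ht.ne'
  have h2 : ∀ u, coeffIntegrand α l (2 * Real.pi / l * u) =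
      ((Real.exp (α * Real.pi / 6 * l) * l ^ (-(α / 2)) : ℝ) : ℂ) * saddleKernel α l u :=
    exp_logEuler_eq_saddleKernel α hl
  simp_rw [h2] at h
  rw [intervalIntegral.integral_const_mul, mul_neg, mul_one, Complex.real_smul] at h
  rw [Complex.ofReal_mul, mul_assoc, h, ← mul_assoc, ← Complex.ofReal_mul, mul_inv_cancel₀ ht.ne',
    Complex.ofReal_one, one_mul]

/-- Away from the saddle point the integrand is smaller than at it by the factor
`e ^ (-αl / (84π))`. -/
theorem eventually_norm_coeffIntegrand_le {α : ℝ} (hα : 0 < α) : ∀ᶠ l in atTop, ∀ θ : ℝ,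
    |θ| ≤ Real.pi → 2 * Real.pi / l ≤ |θ| → ‖coeffIntegrand α l θ‖ ≤
      Real.exp (α * Real.pi / 6 * l) * l ^ (-(α / 2)) *
        (Real.exp (α / 2 * Real.log 2 + α) * Real.exp (-(α / (84 * Real.pi)) * l)) := by
  have hq : ∀ᶠ l : ℝ in atTop, 1 / 2 < Real.exp (-(2 * Real.pi / l)) := by
    have h1 : Tendsto (fun l : ℝ => 2 * Real.pi / l) atTop (𝓝 0) :=
      tendsto_id.const_div_atTop _
    have h2 := (Real.continuous_exp.tendsto _).comp h1.neg
    rw [neg_zero, Real.exp_zero] at h2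
    exact h2.eventually_const_lt (by norm_num)
  filter_upwards [hq, eventually_norm_saddleKernel_le hα, eventually_gt_atTop 0]
    with l hql hker hl θ hθ hθl
  have ht : 0 < 2 * Real.pi / l := by positivity
  -- At `u = 0` this gives the size of the integrand at the saddle point itself.
  have h0 := exp_logEuler_eq_saddleKernel α hl 0
  rw [mul_zero, Complex.ofReal_zero, zero_mul, add_zero] at h0
  have h0n := congrArg norm h0
  rw [norm_mul, Complex.norm_real, Real.norm_of_nonneg (by positivity), Complex.norm_exp,
    Complex.add_re, Complex.re_ofReal_mul, Complex.re_ofReal_mul, Complex.ofReal_re] at h0n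
  have hk := hker 0 (by simp)
  have hG := re_logEuler_le_sub ht hθ hθl hql.le
  have hdecay : ‖coeffIntegrand α l θ‖ ≤
      Real.exp (α * (logEuler (2 * Real.pi / l : ℝ)).re +
        α * (1 + l ^ 2) / 24 * (2 * Real.pi / l)) * Real.exp (-(α / (84 * Real.pi)) * l) := by
    rw [coeffIntegrand, Complex.norm_exp, ← Real.exp_add, Real.exp_le_exp, Complex.add_re,
      Complex.re_ofReal_mul, Complex.re_ofReal_mul]
    have e1 : (((2 * Real.pi / l : ℝ) : ℂ) + θ * Complex.I).re = 2 * Real.pi / l := by simp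
    have e2 : α * (1 / (42 * (2 * Real.pi / l))) = α / (84 * Real.pi) * l := by
      field_simp
      norm_num
    have h3 := mul_le_mul_of_nonneg_left hG hα.le
    rw [mul_sub, e2] at h3
    rw [e1]
    linarith
  rw [h0n] at hdecay
  refine hdecay.trans ?_
  rw [← mul_assoc]
  gcongr
  simpa using hk

/-- The part `|θ| ≤ 2π / l` of the coefficient integral gives the limit, by Laplace's method; the
rest is exponentially smaller. -/
theorem tendsto_integral_coeffIntegrand {α : ℝ} (hα : 0 < α) :
    Tendsto (fun l : ℝ => (∫ θ in (-Real.pi)..Real.pi, coeffIntegrand α l θ) /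
      ((Real.exp (α * Real.pi / 6 * l) / l ^ ((α + 3) / 2) : ℝ) : ℂ)) atTop
      (𝓝 ((2 * Real.pi * √(12 / α) : ℝ) : ℂ)) := by
  set E : ℝ → ℝ := fun l => Real.exp (α * Real.pi / 6 * l) / l ^ ((α + 3) / 2) with hE
  have hEpos : ∀ l, 0 < l → 0 < E l := fun l hl => by positivity
  have hEeq : ∀ l, 0 < l → Real.exp (α * Real.pi / 6 * l) * l ^ (-(α / 2)) = E l * l ^ (3 / 2 : ℝ) :=
    fun l hl => by
      have h : l ^ (-(α / 2)) = l ^ (3 / 2 : ℝ) / l ^ ((α + 3) / 2) := by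
        rw [← Real.rpow_sub hl]
        ring_nf
      rw [h]
      ring
  set near : ℝ → ℂ := fun l => ∫ θ in (-(2 * Real.pi / l))..(2 * Real.pi / l), coeffIntegrand α l θ
  set far : ℝ → ℂ := fun l => (∫ θ in (-Real.pi)..(-(2 * Real.pi / l)), coeffIntegrand α l θ) +
    ∫ θ in (2 * Real.pi / l)..Real.pi, coeffIntegrand α l θ
  have hsplit : ∀ᶠ l in atTop, (near l / E l + far l / E l) =
      (∫ θ in (-Real.pi)..Real.pi, coeffIntegrand α l θ) / E l := by
    filter_upwards [eventually_gt_atTop 0] with l hl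
    have hi : ∀ a b, IntervalIntegrable (coeffIntegrand α l) volume a b := fun a b =>
      (continuous_coeffIntegrand α hl).intervalIntegrable a b
    rw [← add_div, ← intervalIntegral.integral_add_adjacent_intervals (hi _ _) (hi (2 * Real.pi / l) _),
      ← intervalIntegral.integral_add_adjacent_intervals (hi _ _) (hi (-(2 * Real.pi / l)) _)]
    simp only [near, far]
    ring
  have hnear : Tendsto (fun l => near l / E l) atTop (𝓝 ((2 * Real.pi * √(12 / α) : ℝ) : ℂ)) := by
    have h := (tendsto_integral_saddleKernel hα).const_mul
      ((2 * Real.pi / √(Real.pi * α / 12) : ℝ) : ℂ)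
    have hquot : Real.pi / (Real.pi * α / 12) = 12 / α := by field_simp
    have hlim : ((2 * Real.pi / √(Real.pi * α / 12) : ℝ) : ℂ) * (√Real.pi : ℝ) =
        ((2 * Real.pi * √(12 / α) : ℝ) : ℂ) := by
      rw [← Complex.ofReal_mul, div_mul_eq_mul_div, mul_div_assoc, ← Real.sqrt_div' _ (by positivity),
        hquot]
    rw [hlim] at h
    refine h.congr' ?_
    filter_upwards [eventually_gt_atTop 0] with l hl
    have hE0 : (E l : ℂ) ≠ 0 := by exact_mod_cast (hEpos l hl).ne'
    simp only [near]
    rw [integral_coeffIntegrand_near α hl, hEeq l hl, ← mul_assoc, mul_div_right_comm _ _ (E l : ℂ)]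
    congr 1
    rw [eq_div_iff hE0, ← Complex.ofReal_mul, ← Complex.ofReal_mul]
    congr 1
    have h32 : l ^ (3 / 2 : ℝ) = l * √l := by
      rw [Real.sqrt_eq_rpow, ← Real.rpow_one_add' hl.le (by norm_num)]
      norm_num
    rw [h32, Real.sqrt_mul (by positivity)]
    field_simp
  have hfar : Tendsto (fun l => far l / E l) atTop (𝓝 0) := by
    have h1 : Tendsto (fun l : ℝ => 2 * Real.pi * Real.exp (α / 2 * Real.log 2 + α) *
        (l ^ (3 / 2 : ℝ) * Real.exp (-(α / (84 * Real.pi)) * l))) atTop (𝓝 0) := by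
      simpa using (tendsto_rpow_mul_exp_neg_mul_atTop_nhds_zero (3 / 2) (α / (84 * Real.pi))
        (by positivity)).const_mul (2 * Real.pi * Real.exp (α / 2 * Real.log 2 + α))
    refine squeeze_zero_norm' ?_ h1
    filter_upwards [eventually_norm_coeffIntegrand_le hα, eventually_ge_atTop 2] with l hb hl2
    have hl : 0 < l := by linarith
    have ht : 0 < 2 * Real.pi / l := by positivity
    have htpi : 2 * Real.pi / l ≤ Real.pi := by
      rw [div_le_iff₀ hl]
      nlinarith [Real.pi_pos]
    set C := Real.exp (α * Real.pi / 6 * l) * l ^ (-(α / 2)) *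
        (Real.exp (α / 2 * Real.log 2 + α) * Real.exp (-(α / (84 * Real.pi)) * l)) with hC
    have hC0 : 0 ≤ C := by positivity
    have hb1 : ‖∫ θ in (-Real.pi)..(-(2 * Real.pi / l)), coeffIntegrand α l θ‖ ≤
        C * |-(2 * Real.pi / l) - -Real.pi| := by
      refine intervalIntegral.norm_integral_le_of_norm_le_const fun θ hθ => ?_
      rw [Set.uIoc_of_le (by linarith)] at hθ
      have : |θ| = -θ := abs_of_nonpos (by linarith [hθ.2])
      exact hb θ (by linarith [hθ.1]) (by linarith [hθ.2])
    have hb2 : ‖∫ θ in (2 * Real.pi / l)..Real.pi, coeffIntegrand α l θ‖ ≤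
        C * |Real.pi - 2 * Real.pi / l| := by
      refine intervalIntegral.norm_integral_le_of_norm_le_const fun θ hθ => ?_
      rw [Set.uIoc_of_le htpi] at hθ
      have : |θ| = θ := abs_of_nonneg (by linarith [hθ.1])
      exact hb θ (by linarith [hθ.2]) (by linarith [hθ.1])
    rw [abs_of_nonneg (by linarith)] at hb1 hb2
    have hfarle : ‖far l‖ ≤ 2 * Real.pi * C := by
      refine (norm_add_le _ _).trans ?_
      nlinarith
    rw [norm_div, Complex.norm_real, Real.norm_of_nonneg (hEpos l hl).le,
      div_le_iff₀ (hEpos l hl)]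
    refine hfarle.trans (le_of_eq ?_)
    rw [hC, hEeq l hl]
    ring
  have h := hnear.add hfar
  rw [add_zero] at h
  exact h.congr' hsplit

theorem tendsto_lam_atTop {α : ℝ} (hα : 0 < α) : Tendsto (lam α) atTop atTop := by
  refine Real.tendsto_sqrt_atTop.comp (tendsto_atTop_add_const_right _ (-1) ?_)
  exact (tendsto_natCast_atTop_atTop.const_mul_atTop (by norm_num)).atTop_div_const hα

theorem eventually_natCast_eq_lam {α : ℝ} (hα : 0 < α) :
    ∀ᶠ n : ℕ in atTop, (n : ℝ) = α * (1 + lam α n ^ 2) / 24 := by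
  filter_upwards [(tendsto_lam_atTop hα).eventually_gt_atTop 0] with n hn
  rw [lam, Real.sq_sqrt (Real.sqrt_pos.mp hn).le]
  field_simp
  ring

theorem fracPartition_isEquivalent {α : ℝ} (hα : 0 < α) :
    (fun n : ℕ => fracPartition α n) ~[atTop] fun n : ℕ => √(12 / α) *
      (Real.exp (α * Real.pi / 6 * lam α n) / lam α n ^ ((α + 3) / 2)) := by
  have hpos : ∀ᶠ n in atTop, 0 < lam α n := (tendsto_lam_atTop hα).eventually_gt_atTop 0
  have hB : 0 < √(12 / α) := Real.sqrt_pos.mpr (by positivity)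
  rw [isEquivalent_iff_tendsto_one (by
    filter_upwards [hpos] with n hn
    positivity)]
  have h1 := (tendsto_integral_coeffIntegrand hα).comp (tendsto_lam_atTop hα)
  have h2 := (Complex.continuous_re.tendsto _).comp h1
  have h3 := h2.div_const (2 * Real.pi * √(12 / α))
  rw [Complex.ofReal_re, div_self (by positivity)] at h3
  refine h3.congr' ?_
  filter_upwards [hpos, eventually_natCast_eq_lam hα] with n hn hlam
  have h4 := integral_exp_logEuler α (show 0 < 2 * Real.pi / lam α n by positivity) n
  have h5 : ∀ θ : ℝ, Complex.exp (α * logEuler ((2 * Real.pi / lam α n : ℝ) + θ * Complex.I) +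
      n * ((2 * Real.pi / lam α n : ℝ) + θ * Complex.I)) = coeffIntegrand α (lam α n) θ := fun θ => by
    rw [coeffIntegrand, ← hlam, Complex.ofReal_natCast]
  simp_rw [h5] at h4
  simp only [Function.comp_apply, h4, Pi.div_apply]
  have h6 : 2 * (Real.pi : ℂ) * (fracPartition α n : ℂ) =
      ((2 * Real.pi * fracPartition α n : ℝ) : ℂ) := by push_cast; rfl
  rw [h6, ← Complex.ofReal_div, Complex.ofReal_re]
  field_simp

/-! ### The modified Bessel function for large argument -/

theorem ofReal_beta_integrand (a b : ℝ) {x : ℝ} (hx : x ∈ Set.Ioc (0 : ℝ) 1) :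
    ((x ^ (a - 1) * (1 - x) ^ (b - 1) : ℝ) : ℂ) =
      (x : ℂ) ^ ((a : ℂ) - 1) * (1 - (x : ℂ)) ^ ((b : ℂ) - 1) := by
  rw [Complex.ofReal_mul, Complex.ofReal_cpow hx.1.le, Complex.ofReal_cpow (by linarith [hx.2])]
  push_cast
  rfl

theorem integrableOn_beta {a b : ℝ} (ha : 0 < a) (hb : 0 < b) :
    IntegrableOn (fun x : ℝ => x ^ (a - 1) * (1 - x) ^ (b - 1)) (Set.Ioc 0 1) := by
  have h := (intervalIntegrable_iff_integrableOn_Ioc_of_le zero_le_one).mp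
    (Complex.betaIntegral_convergent (u := a) (v := b) (by simpa) (by simpa))
  refine (Integrable.re h).congr ?_
  filter_upwards [ae_restrict_mem measurableSet_Ioc] with x hx
  rw [← ofReal_beta_integrand a b hx]
  simp

theorem integral_beta {a b : ℝ} (ha : 0 < a) (hb : 0 < b) :
    ∫ x in Set.Ioc (0 : ℝ) 1, x ^ (a - 1) * (1 - x) ^ (b - 1) =
      Real.Gamma a * Real.Gamma b / Real.Gamma (a + b) := by
  have hG : Real.Gamma (a + b) ≠ 0 := (Real.Gamma_pos_of_pos (by positivity)).ne'
  have h := Complex.Gamma_mul_Gamma_eq_betaIntegral (s := a) (t := b) (by simpa) (by simpa)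
  have h2 : Complex.betaIntegral a b =
      ((∫ x in Set.Ioc (0 : ℝ) 1, x ^ (a - 1) * (1 - x) ^ (b - 1) : ℝ) : ℂ) := by
    rw [Complex.betaIntegral, intervalIntegral.integral_of_le zero_le_one, ← integral_complex_ofReal]
    refine setIntegral_congr_fun measurableSet_Ioc fun x hx => ?_
    exact (ofReal_beta_integrand a b hx).symm
  rw [h2, ← Complex.ofReal_add, Complex.Gamma_ofReal, Complex.Gamma_ofReal, Complex.Gamma_ofReal]
    at h
  rw [eq_div_iff hG, mul_comm]
  exact_mod_cast h.symm

theorem sqrt_pow_two_mul_add_one {x : ℝ} (hx : 0 ≤ x) (k : ℕ) :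
    √x ^ (2 * k + 1) = x ^ ((k : ℝ) + 3 / 2 - 1) := by
  rw [Real.sqrt_eq_rpow, ← Real.rpow_mul_natCast hx]
  congr 1
  push_cast
  ring

/-- The terms of the Bessel series as Beta integrals, through the duplication formula for
`Γ(k + 1) Γ(k + 3 / 2)`. -/
theorem integral_sinh_term {μ : ℝ} (hμ : 0 < μ) (z : ℝ) (k : ℕ) :
    ∫ x in Set.Ioc (0 : ℝ) 1, x ^ (μ - 1) * ((z * √(1 - x)) ^ (2 * k + 1) / ((2 * k + 1)! : ℝ)) =
      √Real.pi * Real.Gamma μ * (z / 2) *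
        ((z / 2) ^ (2 * k) / ((k ! : ℝ) * Real.Gamma (μ + 1 / 2 + k + 1))) := by
  have h1 : ∫ x in Set.Ioc (0 : ℝ) 1,
      x ^ (μ - 1) * ((z * √(1 - x)) ^ (2 * k + 1) / ((2 * k + 1)! : ℝ)) =
      ∫ x in Set.Ioc (0 : ℝ) 1, z ^ (2 * k + 1) / ((2 * k + 1)! : ℝ) *
        (x ^ (μ - 1) * (1 - x) ^ ((k : ℝ) + 3 / 2 - 1)) := by
    refine setIntegral_congr_fun measurableSet_Ioc fun x hx => ?_
    simp only [mul_pow]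
    rw [sqrt_pow_two_mul_add_one (by linarith [hx.2])]
    ring
  have hdup := Real.Gamma_mul_Gamma_add_half ((k : ℝ) + 1)
  have hG2 : Real.Gamma (2 * ((k : ℝ) + 1)) = ((2 * k + 1)! : ℝ) := by
    rw [← Real.Gamma_nat_eq_factorial]
    congr 1
    push_cast
    ring
  have hpow : (2 : ℝ) ^ (1 - 2 * ((k : ℝ) + 1)) = 1 / 2 ^ (2 * k + 1) := by
    rw [one_div, ← Real.rpow_natCast, ← Real.rpow_neg zero_le_two]
    congr 1
    push_cast
    ring
  rw [Real.Gamma_nat_eq_factorial, hG2, hpow,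
    show (k : ℝ) + 1 + 1 / 2 = k + 3 / 2 by ring] at hdup
  have hk : (k ! : ℝ) ≠ 0 := by exact_mod_cast Nat.factorial_ne_zero k
  have hk2 : ((2 * k + 1)! : ℝ) ≠ 0 := by exact_mod_cast Nat.factorial_ne_zero _
  have hGk : Real.Gamma ((k : ℝ) + 3 / 2) =
      ((2 * k + 1)! : ℝ) * (1 / 2 ^ (2 * k + 1)) * √Real.pi / (k ! : ℝ) := by
    rw [eq_div_iff hk, mul_comm, hdup]
  have hG : Real.Gamma (μ + 1 / 2 + k + 1) ≠ 0 := (Real.Gamma_pos_of_pos (by positivity)).ne'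
  rw [h1, integral_const_mul, integral_beta hμ (by positivity), hGk,
    show μ + ((k : ℝ) + 3 / 2) = μ + 1 / 2 + k + 1 by ring, div_pow, pow_succ, pow_succ]
  field_simp

/-- Poisson's integral representation of the modified Bessel function, in the variant with `sinh`,
whose only endpoint singularity is the integrable `x ^ (μ - 1)` at `0`. -/
theorem besselI_eq_integral {μ z : ℝ} (hμ : 0 < μ) (hz : 0 < z) :
    besselI (μ + 1 / 2) z = (z / 2) ^ (μ - 1 / 2) / (√Real.pi * Real.Gamma μ) *
      ∫ x in Set.Ioc (0 : ℝ) 1, x ^ (μ - 1) * Real.sinh (z * √(1 - x)) := by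
  set F : ℕ → ℝ → ℝ := fun k x =>
    x ^ (μ - 1) * ((z * √(1 - x)) ^ (2 * k + 1) / ((2 * k + 1)! : ℝ)) with hF
  have hGμ : 0 < Real.Gamma μ := Real.Gamma_pos_of_pos hμ
  have hnonneg : ∀ k, ∀ x ∈ Set.Ioc (0 : ℝ) 1, 0 ≤ F k x := fun k x hx => by
    have := hx.1
    positivity
  have hint : ∀ k, Integrable (F k) (volume.restrict (Set.Ioc 0 1)) := fun k => by
    refine ((integrableOn_beta hμ (show 0 < (k : ℝ) + 3 / 2 by positivity)).const_mul
      (z ^ (2 * k + 1) / ((2 * k + 1)! : ℝ))).congr ?_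
    filter_upwards [ae_restrict_mem measurableSet_Ioc] with x hx
    simp only [hF, mul_pow]
    rw [sqrt_pow_two_mul_add_one (by linarith [hx.2])]
    ring
  have hsummable := summable_besselI (ν := μ + 1 / 2) (by positivity) z
  have hnorm : ∀ k, ∫ x in Set.Ioc (0 : ℝ) 1, ‖F k x‖ = ∫ x in Set.Ioc (0 : ℝ) 1, F k x := fun k =>
    setIntegral_congr_fun measurableSet_Ioc fun x hx => Real.norm_of_nonneg (hnonneg k x hx)
  have key := hasSum_integral_of_summable_integral_norm hint (by
    simp_rw [hnorm, hF, integral_sinh_term hμ z]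
    exact hsummable.mul_left _)
  simp_rw [hF, integral_sinh_term hμ z] at key
  have hsum : ∀ x, ∑' k : ℕ, x ^ (μ - 1) * ((z * √(1 - x)) ^ (2 * k + 1) / ((2 * k + 1)! : ℝ)) =
      x ^ (μ - 1) * Real.sinh (z * √(1 - x)) := fun x =>
    ((Real.hasSum_sinh (z * √(1 - x))).mul_left (x ^ (μ - 1))).tsum_eq
  simp_rw [hsum] at key
  rw [key.unique (hsummable.hasSum.mul_left _), besselI,
    show μ + 1 / 2 = (μ - 1 / 2) + 1 by ring, Real.rpow_add_one (by positivity)]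
  have : √Real.pi ≠ 0 := (Real.sqrt_pos.mpr Real.pi_pos).ne'
  field_simp

theorem mul_sqrt_one_sub_sub {y z : ℝ} (hy : y ≤ z) (hz : 0 < z) :
    z * √(1 - y / z) - z = -y / (√(1 - y / z) + 1) := by
  have h0 : 0 ≤ 1 - y / z := sub_nonneg.mpr ((div_le_one hz).mpr hy)
  have h1 : √(1 - y / z) + 1 ≠ 0 := by positivity
  rw [eq_div_iff h1]
  have h2 : (z * √(1 - y / z) - z) * (√(1 - y / z) + 1) = z * (√(1 - y / z) ^ 2 - 1) := by ring
  rw [h2, Real.sq_sqrt h0]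
  field_simp
  ring

/-- Laplace's method at the endpoint `x = 0`: after the substitution `x = y / z` the integrand is
dominated by `y ^ (μ - 1) * e ^ (-y / 2)`. -/
theorem tendsto_integral_sinh {μ : ℝ} (hμ : 0 < μ) :
    Tendsto (fun z : ℝ => z ^ μ * Real.exp (-z) *
      ∫ x in Set.Ioc (0 : ℝ) 1, x ^ (μ - 1) * Real.sinh (z * √(1 - x))) atTop
      (𝓝 (2 ^ μ * Real.Gamma μ / 2)) := by
  set F : ℝ → ℝ → ℝ := fun z => (Set.Ioc 0 z).indicator fun y =>
    y ^ (μ - 1) * (Real.exp (-z) * Real.sinh (z * √(1 - y / z))) with hF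
  have hsub : ∀ᶠ z in atTop, ∫ y in Set.Ioi (0 : ℝ), F z y = z ^ μ * Real.exp (-z) *
      ∫ x in Set.Ioc (0 : ℝ) 1, x ^ (μ - 1) * Real.sinh (z * √(1 - x)) := by
    filter_upwards [eventually_gt_atTop 0] with z hz
    have h := intervalIntegral.integral_comp_div (a := 0) (b := z)
      (fun x : ℝ => x ^ (μ - 1) * Real.sinh (z * √(1 - x))) hz.ne'
    rw [zero_div, div_self hz.ne', intervalIntegral.integral_of_le hz.le,
      intervalIntegral.integral_of_le zero_le_one, smul_eq_mul] at h
    rw [hF, setIntegral_indicator measurableSet_Ioc,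
      Set.inter_eq_self_of_subset_right Set.Ioc_subset_Ioi_self]
    have hzμ : z ^ μ = z ^ (μ - 1) * z := by
      rw [← Real.rpow_add_one hz.ne']
      ring_nf
    rw [hzμ, show z ^ (μ - 1) * z * Real.exp (-z) * (∫ x in Set.Ioc (0 : ℝ) 1,
      x ^ (μ - 1) * Real.sinh (z * √(1 - x))) = z ^ (μ - 1) * Real.exp (-z) *
      (z * ∫ x in Set.Ioc (0 : ℝ) 1, x ^ (μ - 1) * Real.sinh (z * √(1 - x))) by ring, ← h,
      ← integral_const_mul]
    refine setIntegral_congr_fun measurableSet_Ioc fun y hy => ?_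
    rw [Real.div_rpow hy.1.le hz.le]
    have : z ^ (μ - 1) ≠ 0 := (Real.rpow_pos_of_pos hz _).ne'
    field_simp
  have hlim : 2 ^ μ * Real.Gamma μ / 2 =
      ∫ y in Set.Ioi (0 : ℝ), y ^ (μ - 1) * (Real.exp (-(1 / 2 * y)) / 2) := by
    simp_rw [← mul_div_assoc]
    rw [integral_div, Real.integral_rpow_mul_exp_neg_mul_Ioi hμ (by norm_num)]
    norm_num
  rw [hlim]
  refine Tendsto.congr' hsub ?_
  refine tendsto_integral_filter_of_dominated_convergence
    (fun y => y ^ (μ - 1) * Real.exp (-(1 / 2) * y)) ?_ ?_ ?_ ?_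
  · refine .of_forall fun z => Measurable.aestronglyMeasurable ?_
    refine Measurable.indicator ?_ measurableSet_Ioc
    have := Real.measurable_sinh
    fun_prop
  · filter_upwards [eventually_gt_atTop 0] with z hz
    filter_upwards [ae_restrict_mem measurableSet_Ioi] with y hy
    have hy0 : 0 < y := hy
    by_cases hyz : y ∈ Set.Ioc 0 z
    · simp only [hF, Set.indicator_of_mem hyz]
      have hs0 : 0 ≤ z * √(1 - y / z) := by positivity
      have hsinh : 0 ≤ Real.sinh (z * √(1 - y / z)) := Real.sinh_nonneg_iff.mpr hs0
      rw [Real.norm_of_nonneg (by positivity)]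
      gcongr
      have h1 : Real.sinh (z * √(1 - y / z)) ≤ Real.exp (z * √(1 - y / z)) := by
        rw [Real.sinh_eq]
        have := Real.exp_pos (z * √(1 - y / z))
        have := Real.exp_pos (-(z * √(1 - y / z)))
        linarith
      refine (mul_le_mul_of_nonneg_left h1 (Real.exp_pos _).le).trans ?_
      rw [← Real.exp_add, Real.exp_le_exp, neg_add_eq_sub, mul_sqrt_one_sub_sub hyz.2 hz]
      have h2 : √(1 - y / z) ≤ 1 := Real.sqrt_le_one.mpr (by
        have : 0 ≤ y / z := by positivity
        linarith)
      rw [div_le_iff₀ (by positivity)]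
      nlinarith
    · simp only [hF, Set.indicator_of_notMem hyz, norm_zero]
      positivity
  · change IntegrableOn _ _ _
    simpa using integrableOn_rpow_mul_exp_neg_mul_rpow (p := 1) (s := μ - 1) (b := 1 / 2)
      (by linarith) one_pos (by norm_num)
  · filter_upwards [ae_restrict_mem measurableSet_Ioi] with y hy
    have hy0 : 0 < y := hy
    have h1 : Tendsto (fun z : ℝ => √(1 - y / z)) atTop (𝓝 1) := by
      have h := (Real.continuous_sqrt.tendsto _).comp
        ((tendsto_id.const_div_atTop y).const_sub (1 : ℝ))
      rw [sub_zero, Real.sqrt_one] at h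
      exact h
    have h2 : Tendsto (fun z : ℝ => -y / (√(1 - y / z) + 1)) atTop (𝓝 (-(1 / 2 * y))) := by
      have h := (tendsto_const_nhds (x := -y)).div (h1.add_const 1) (by norm_num)
      rw [show -y / (1 + 1) = -(1 / 2 * y) by ring] at h
      exact h
    have h3 : Tendsto (fun z : ℝ => Real.exp (-z - z * √(1 - y / z))) atTop (𝓝 0) := by
      refine Real.tendsto_exp_atBot.comp
        (tendsto_atBot_mono' atTop ?_ tendsto_neg_atTop_atBot)
      filter_upwards [eventually_gt_atTop 0] with z hz
      have : 0 ≤ z * √(1 - y / z) := by positivity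
      linarith
    have h4 := (((Real.continuous_exp.tendsto _).comp h2).sub h3).div_const 2 |>.const_mul
      (y ^ (μ - 1))
    rw [sub_zero] at h4
    refine h4.congr' ?_
    filter_upwards [eventually_ge_atTop y, eventually_gt_atTop 0] with z hyz hz
    simp only [hF]
    rw [Set.indicator_of_mem (show y ∈ Set.Ioc 0 z from ⟨hy0, hyz⟩), Function.comp_apply,
      ← mul_sqrt_one_sub_sub hyz hz, Real.sinh_eq,
      show z * √(1 - y / z) - z = -z + z * √(1 - y / z) by ring, sub_eq_add_neg (-z) (z * _),
      Real.exp_add, Real.exp_add]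
    ring

theorem besselI_isEquivalent {ν : ℝ} (hν : 1 / 2 < ν) :
    besselI ν ~[atTop] fun z => Real.exp z / √(2 * Real.pi * z) := by
  obtain ⟨μ, hμ, rfl⟩ : ∃ μ, 0 < μ ∧ ν = μ + 1 / 2 := ⟨ν - 1 / 2, by linarith, by ring⟩
  rw [isEquivalent_iff_tendsto_one (by
    filter_upwards [eventually_gt_atTop 0] with z hz
    have := Real.pi_pos
    positivity)]
  have hG : 0 < Real.Gamma μ := Real.Gamma_pos_of_pos hμ
  have h := (tendsto_integral_sinh hμ).div_const (2 ^ μ * Real.Gamma μ / 2)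
  rw [div_self (by positivity)] at h
  refine h.congr' ?_
  filter_upwards [eventually_gt_atTop 0] with z hz
  rw [Pi.div_apply, besselI_eq_integral hμ hz]
  have hs : (z / 2) ^ (μ - 1 / 2) * √(2 * Real.pi * z) = z ^ μ / 2 ^ μ * 2 * √Real.pi := by
    have hz2 : 2 * Real.pi * z = Real.pi * (z / 2) * 2 ^ 2 := by ring
    rw [hz2, Real.sqrt_mul (by positivity), Real.sqrt_sq zero_le_two,
      Real.sqrt_mul Real.pi_pos.le, Real.sqrt_eq_rpow (z / 2), ← Real.div_rpow hz.le zero_le_two]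
    have : (z / 2) ^ μ = (z / 2) ^ (μ - 1 / 2) * (z / 2) ^ (1 / 2 : ℝ) := by
      rw [← Real.rpow_add (by positivity)]
      ring_nf
    rw [this]
    ring
  have hpi : √Real.pi ≠ 0 := (Real.sqrt_pos.mpr Real.pi_pos).ne'
  generalize ∫ x in Set.Ioc (0 : ℝ) 1, x ^ (μ - 1) * Real.sinh (z * √(1 - x)) = J
  have hre : (z / 2) ^ (μ - 1 / 2) / (√Real.pi * Real.Gamma μ) * J /
      (Real.exp z / √(2 * Real.pi * z)) = (z / 2) ^ (μ - 1 / 2) * √(2 * Real.pi * z) * J /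
        (√Real.pi * Real.Gamma μ * Real.exp z) := by
    rw [div_div_eq_mul_div, div_mul_eq_mul_div, div_mul_eq_mul_div, div_div, mul_right_comm]
  rw [hre, hs, Real.exp_neg]
  field_simp

theorem besselI_lam_isEquivalent {α : ℝ} (hα : 0 < α) :
    (fun n : ℕ => 2 * Real.pi * (besselI (α / 2 + 1) (Real.pi * α / 6 * lam α n) /
      lam α n ^ (α / 2 + 1))) ~[atTop] fun n : ℕ => √(12 / α) *
        (Real.exp (α * Real.pi / 6 * lam α n) / lam α n ^ ((α + 3) / 2)) := by
  have hc : 0 < Real.pi * α / 6 := by positivity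
  have h1 := (besselI_isEquivalent (ν := α / 2 + 1) (by linarith)).comp_tendsto
    ((tendsto_lam_atTop hα).const_mul_atTop hc)
  have h2 := (IsEquivalent.refl (u := fun _ : ℕ => 2 * Real.pi) (l := atTop)).mul
    (h1.div (IsEquivalent.refl (u := fun n : ℕ => lam α n ^ (α / 2 + 1))))
  refine h2.trans (EventuallyEq.isEquivalent ?_)
  filter_upwards [(tendsto_lam_atTop hα).eventually_gt_atTop 0] with n hn
  simp only [Pi.mul_apply, Pi.div_apply, Function.comp_apply]
  set l := lam α n
  have e1 : l ^ ((α + 3) / 2) = l ^ (α / 2 + 1) * √l := by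
    rw [Real.sqrt_eq_rpow, ← Real.rpow_add hn]
    ring_nf
  have e2 : √(2 * Real.pi * (Real.pi * α / 6 * l)) = 2 * Real.pi / √(12 / α) * √l := by
    have : 2 * Real.pi * (Real.pi * α / 6 * l) = (2 * Real.pi) ^ 2 / (12 / α) * l := by
      field_simp
      norm_num
    rw [this, Real.sqrt_mul (by positivity), Real.sqrt_div (by positivity),
      Real.sqrt_sq (by positivity)]
  have hs : √(12 / α) ≠ 0 := (Real.sqrt_pos.mpr (by positivity)).ne'
  have hl : √l ≠ 0 := (Real.sqrt_pos.mpr hn).ne'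
  rw [e1, e2, show Real.pi * α / 6 * l = α * Real.pi / 6 * l by ring]
  field_simp

end FracPartition

theorem corollary1p2 (α : ℝ) (hα : 0 < α) :
    ((fun n : ℕ => FracPartition.fracPartition α n) ~[atTop]
      (fun n : ℕ => 2 * Real.pi *
        (FracPartition.besselI (α / 2 + 1) (Real.pi * α / 6 * FracPartition.lam α n) /
          FracPartition.lam α n ^ (α / 2 + 1)))) ∧
    ((fun n : ℕ => 2 * Real.pi *
        (FracPartition.besselI (α / 2 + 1) (Real.pi * α / 6 * FracPartition.lam α n) /
          FracPartition.lam α n ^ (α / 2 + 1))) ~[atTop]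
      (fun n : ℕ => Real.sqrt (12 / α) *
        (Real.exp (α * Real.pi / 6 * FracPartition.lam α n) /
          FracPartition.lam α n ^ ((α + 3) / 2)))) :=
  ⟨(FracPartition.fracPartition_isEquivalent hα).trans
    (FracPartition.besselI_lam_isEquivalent hα).symm, FracPartition.besselI_lam_isEquivalent hα⟩
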